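/- Conventions. For a valuation domain $R$ (an integral domain whose ideals are totally ordered by inclusion) let $Q$ be its quotient field. An $R$-module $U$ is uniserial if its submodules are totally ordered by inclusion, and standard if $U\cong J/A$ for some $R$-submodules $A\subseteq J$ of $Q$. For $0\ne a\in U$ put $\mathrm{Ann}(a)=\{r\in R: ra=0\}$ and $D(a)=\bigcup\{r^{-1}R: r \text{ divides } a \text{ in } U\}\subseteq Q$; a uniserial module $U$ is of type $J/A$ if $D(a)/\mathrm{Ann}(a)\cong J/A$ for some (equivalently, every) $0\neq a\in U$. Call two subsets of $\omega_1$ equivalent if they have the same intersection with some closed unbounded subset of $\omega_1$; let $1$ be the class of $\omega_1$. If $J=\bigcup_{\nu<\omega_1}r_\nu^{-1}R$ with non-zero $r_\nu\in R$ such that $r_\mu\mid r_\nu$ for $\mu<\nu$, put $J_\delta=\bigcup_{\nu<\delta}r_\nu^{-1}R$ and let $\Gamma_R(J/A)$ be the class of the set of all limit ordinals $\delta<\omega_1$ such that $R/(A:J_\delta)$ is not complete in the linear topology in which the images of the submodules $r_\nu A$ ($\nu<\delta$) form a basis of neighbourhoods of $0$; this class does not depend on the choice of the sequence $(r_\nu)$.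 Theorem (ZFC). There is a valuation domain $R$ of cardinality $2^{\aleph_1}$, not a field, such that its quotient field $Q$ is generated as an $R$-module by $\aleph_1$ elements and is such a union, and $\Gamma_R(Q/R)=1$, but every uniserial $R$-module of type $Q/R$ is standard. -/

import Mathlib

open scoped Pointwise Uniformity

universe u v

/-! ### Uniserial modules, standard uniserial modules, types -/

/-- A module is uniserial if its submodules are totally ordered by inclusion. -/
def IsUniserial (R : Type*) (U : Type*) [CommRing R] [AddCommGroup U] [Module R U] : Prop :=
  ∀ N₁ N₂ : Submodule R U, N₁ ≤ N₂ ∨ N₂ ≤ N₁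

/-- Mathlib's valuation rings that are domains are exactly the domains that are uniserial as modules
over themselves. -/
theorem valuationRing_iff_isUniserial (R : Type*) [CommRing R] [IsDomain R] :
    ValuationRing R ↔ IsUniserial R R :=
  ValuationRing.iff_ideal_total.trans ⟨fun h => h.total, fun h => ⟨h⟩⟩

section Types

variable (R : Type*) [CommRing R] [IsDomain R]

/-- The quotient module `J/A` (used for submodules `A ≤ J` of the quotient field `Q`). -/
abbrev QuotMod (J A : Submodule R (FractionRing R)) : Type _ := J ⧸ A.submoduleOf J

/-- A module is standard if it is isomorphic to `J/A` for some submodules `A ≤ J` of `Q`. -/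
def IsStandard (U : Type*) [AddCommGroup U] [Module R U] : Prop :=
  ∃ J A : Submodule R (FractionRing R), A ≤ J ∧ Nonempty (U ≃ₗ[R] QuotMod R J A)

/-- The cyclic submodule `r⁻¹R` of the quotient field. -/
noncomputable def invSpan (r : R) : Submodule R (FractionRing R) :=
  Submodule.span R {(algebraMap R (FractionRing R) r)⁻¹}

variable {R}

theorem invSpan_mono {r s : R} (hs : s ≠ 0) (h : r ∣ s) : invSpan R r ≤ invSpan R s := by
  obtain ⟨t, rfl⟩ := h
  have hr : algebraMap R (FractionRing R) r ≠ 0 := by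
    simpa using left_ne_zero_of_mul hs
  have ht : algebraMap R (FractionRing R) t ≠ 0 := by
    simpa using right_ne_zero_of_mul hs
  rw [invSpan, Submodule.span_singleton_le_iff_mem, invSpan, Submodule.mem_span_singleton]
  refine ⟨t, ?_⟩
  rw [Algebra.smul_def, map_mul]
  field_simp

variable (R) in
/-- `Ann(a)`, regarded as a submodule of the quotient field. -/
noncomputable def annIn {U : Type*} [AddCommGroup U] [Module R U] (a : U) :
    Submodule R (FractionRing R) :=
  Submodule.map (Algebra.linearMap R (FractionRing R)) (Ideal.torsionOf R U a)

variable (R) in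
/-- `D(a)` is the union of all `r⁻¹R`, where `r ≠ 0` divides `a` in `U`. (For `a ≠ 0` the condition
`r ≠ 0` is automatic.) -/
def divIn [ValuationRing R] {U : Type*} [AddCommGroup U] [Module R U] (a : U) :
    Submodule R (FractionRing R) where
  carrier := ⋃ r ∈ {r : R | r ≠ 0 ∧ ∃ b : U, r • b = a}, (invSpan R r : Set (FractionRing R))
  zero_mem' := by
    simp only [Set.mem_iUnion]
    exact ⟨1, ⟨one_ne_zero, a, one_smul _ _⟩, Submodule.zero_mem _⟩
  add_mem' := by
    intro x y hx hy
    simp only [Set.mem_iUnion] at hx hy ⊢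
    obtain ⟨r, hr, hx⟩ := hx
    obtain ⟨s, hs, hy⟩ := hy
    rcases ValuationRing.dvd_total r s with h | h
    · exact ⟨s, hs, Submodule.add_mem _ (invSpan_mono hs.1 h hx) hy⟩
    · exact ⟨r, hr, Submodule.add_mem _ hx (invSpan_mono hr.1 h hy)⟩
  smul_mem' := by
    intro c x hx
    simp only [Set.mem_iUnion] at hx ⊢
    obtain ⟨r, hr, hx⟩ := hx
    exact ⟨r, hr, Submodule.smul_mem _ _ hx⟩

/-- `U` is of type `J/A` if `D(a)/Ann(a) ≅ J/A` for some non-zero element `a` of `U` (for uniserial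
`U` it does not matter which one). -/
def HasType [ValuationRing R] (U : Type*) [AddCommGroup U] [Module R U]
    (J A : Submodule R (FractionRing R)) : Prop :=
  ∃ a : U, a ≠ 0 ∧ Nonempty (QuotMod R (divIn R a) (annIn R a) ≃ₗ[R] QuotMod R J A)

end Types

/-! ### Subsets of `ω₁` modulo the club filter -/

/-- The set `ω₁` of all countable ordinals. -/
abbrev Omega1 : Type 1 := Set.Iio (Ordinal.omega 1 : Ordinal.{0})

theorem cof_Omega1_ne : Order.cof Omega1 ≠ Cardinal.aleph0 := by
  rw [Ordinal.cof_Iio, Ordinal.lift_omega]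
  simpa using (Cardinal.aleph0_lt_aleph_one).ne'

/-- `S₁` and `S₂` are equivalent if `S₁ ∩ C = S₂ ∩ C` for some cub `C`. -/
instance clubSetoid : Setoid (Set Omega1) where
  r S₁ S₂ := ∃ C : Set Omega1, IsClub C ∧ S₁ ∩ C = S₂ ∩ C
  iseqv :=
    { refl := fun S => ⟨Set.univ, IsClub.univ, rfl⟩
      symm := fun ⟨C, hC, h⟩ => ⟨C, hC, h.symm⟩
      trans := fun {S T U} ⟨C, hC, h⟩ ⟨C', hC', h'⟩ => by
        refine ⟨C ∩ C', hC.inter cof_Omega1_ne hC', ?_⟩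
        rw [← Set.inter_assoc, h, Set.inter_right_comm, h', Set.inter_right_comm, Set.inter_assoc] }

/-- `D(ω₁)`, the set of all equivalence classes of subsets of `ω₁`. -/
def ClubClass : Type 1 := Quotient clubSetoid

/-- The class of a subset of `ω₁`. -/
def ClubClass.mk (S : Set Omega1) : ClubClass := Quotient.mk clubSetoid S

/-- The greatest element of `D(ω₁)`: the class of `ω₁`. -/
instance : One ClubClass := ⟨ClubClass.mk Set.univ⟩

/-- The class of `S` is `1` exactly if `S` contains a cub. -/
theorem ClubClass.mk_eq_one_iff (S : Set Omega1) :
    ClubClass.mk S = 1 ↔ ∃ C : Set Omega1, IsClub C ∧ C ⊆ S := by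
  refine Quotient.eq.trans (exists_congr fun C => and_congr_right fun _ => ?_)
  rw [Set.univ_inter, Set.inter_eq_right]

/-! ### The invariant `Γ` -/

/-- The linear uniform structure on `M` given by a family of submodules `N i`: the coarsest one for
which all quotient maps onto the discrete modules `M/N i` are uniformly continuous. -/
@[reducible]
def linearUniformSpace {R M ι : Type*} [CommRing R] [AddCommGroup M] [Module R M]
    (N : ι → Submodule R M) : UniformSpace M :=
  ⨅ i, UniformSpace.comap (N i).mkQ ⊥

/-- If the `N i` form a chain, then the relations `x - y ∈ N i` are a basis of the uniformity. -/
theorem linearUniformSpace_hasBasis {R M ι : Type*} [CommRing R] [AddCommGroup M] [Module R M]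
    [Nonempty ι] (N : ι → Submodule R M) (hN : Directed (· ≥ ·) N) :
    (𝓤[linearUniformSpace N]).HasBasis (fun _ : ι => True)
      (fun i => {p : M × M | p.1 - p.2 ∈ N i}) := by
  have key : 𝓤[linearUniformSpace N] =
      ⨅ i, Filter.principal {p : M × M | p.1 - p.2 ∈ N i} := by
    rw [linearUniformSpace, iInf_uniformity]
    refine iInf_congr fun i => ?_
    rw [uniformity_comap]
    change Filter.comap _ (Filter.principal _) = _
    rw [Filter.comap_principal]
    congr 1
    ext p
    exact Submodule.Quotient.eq (N i)
  rw [key]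
  refine Filter.hasBasis_iInf_principal fun i j => ?_
  obtain ⟨k, hi, hj⟩ := hN i j
  exact ⟨k, fun p hp => hi hp, fun p hp => hj hp⟩

/-- The neighbourhoods of `0` in the topology of the preceding uniform structure. -/
theorem linearUniformSpace_hasBasis_nhds_zero {R M ι : Type*} [CommRing R] [AddCommGroup M]
    [Module R M] [Nonempty ι] (N : ι → Submodule R M) (hN : Directed (· ≥ ·) N) :
    (@nhds M (linearUniformSpace N).toTopologicalSpace 0).HasBasis (fun _ : ι => True)
      (fun i => (N i : Set M)) := by
  let _ := linearUniformSpace N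
  refine (nhds_basis_uniformity (linearUniformSpace_hasBasis N hN)).congr (fun _ => Iff.rfl) ?_
  intro i _
  ext x
  simp

section Gamma

variable {R : Type*} [CommRing R] [IsDomain R]

/-- `r` is a sequence of non-zero elements with `r μ ∣ r ν` for `μ < ν < ω₁`, such that `J` is the
union of the `(r ν)⁻¹R`. -/
structure IsGenSeq (r : Omega1 → R) (J : Submodule R (FractionRing R)) : Prop where
  ne_zero : ∀ ν, r ν ≠ 0
  dvd : ∀ μ ν, μ < ν → r μ ∣ r ν
  union : (J : Set (FractionRing R)) = ⋃ ν, (invSpan R (r ν) : Set (FractionRing R))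

/-- `J_δ`, the union of the `(r ν)⁻¹R` for `ν < δ`. -/
def partialUnion (r : Omega1 → R) (δ : Omega1) : Set (FractionRing R) :=
  ⋃ ν ∈ Set.Iio δ, (invSpan R (r ν) : Set (FractionRing R))

/-- The image of `r ν • A` in `R/(A : J_δ)`, for `ν < δ`. -/
def nbhdSubmodule (r : Omega1 → R) (A : Submodule R (FractionRing R)) (δ : Omega1)
    (ν : Set.Iio δ) : Submodule R (R ⧸ A.colon (partialUnion r δ)) :=
  Submodule.map (A.colon (partialUnion r δ)).mkQ
    (Submodule.comap (Algebra.linearMap R (FractionRing R)) (r ν • A))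

/-- The set of all limit ordinals `δ < ω₁` such that `R/(A : J_δ)`, with the linear topology given by
the submodules `r ν • A` for `ν < δ`, is not complete. -/
def incompleteSet (r : Omega1 → R) (A : Submodule R (FractionRing R)) : Set Omega1 :=
  {δ | Order.IsSuccLimit δ ∧
    ¬ @CompleteSpace (R ⧸ A.colon (partialUnion r δ)) (linearUniformSpace (nbhdSubmodule r A δ))}

/-- `Γ_R(J/A) = x`: there is a sequence `r` as in `IsGenSeq`, and for every such sequence the class
of the set of all `δ` for which `R/(A : J_δ)` is not complete is `x`. -/
def GammaEq (J A : Submodule R (FractionRing R)) (x : ClubClass) : Prop :=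
  (∃ r : Omega1 → R, IsGenSeq r J) ∧
    ∀ r : Omega1 → R, IsGenSeq r J → ClubClass.mk (incompleteSet r A) = x

end Gamma

/-! `R` consists of the elements of non-negative order in a field `F` of Hahn series whose exponents
are the finitely supported functions ω₁ → ℤ, ordered colexicographically. The monomials r_ν = t^(γ
ν), ν < ω₁, are then such that every non-zero element of `R` divides one of them. Trivializing all
cocycles while keeping the quotients R/⋂ r_ν R incomplete are conflicting demands; generic choices
reconcile them.

A uniserial module of type Q/R is a union of cyclic modules R/r_νR glued by units with e_μν e_ντ ≡
e_μτ mod r_μ. It is isomorphic to Q/R if there are units c_ν with c_μ e_μν ≡ c_ν mod r_μ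
(`isStandard_of_cocycles_trivial`). Over all Hahn series such c exist, by transfinite recursion,
since pseudo-Cauchy families have limits (`IsCocycle.exists_trivialization`). Adjoining c itself
might realize limits that have to stay missing. Stage α therefore adjoins z_ν = x c_ν + y_ν t^(γ ν)
with new independent constants x, y_ν; these trivialize e as well (`le_orderTop_genericUnit`). There
are 2^ℵ₁ stages, every candidate is listed cofinally often, and cof(2^ℵ₁) > ℵ₁ puts all ℵ₁ entries
of a cocycle over `F` below a single stage.

For Γ = 1, let δ be a limit and D ⊆ δ cofinal with finite proper initial segments. The partial sums
of ∑ x_μ t^(γ μ), μ ∈ D, with distinct base constants x_μ, have no limit in the base field, whose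
elements each involve finitely many variables only. No stage creates a limit: by a Gauss valuation
argument, adjoining an element with residue transcendental over the constants in use does not
improve the approximation of series over those constants (`approxBy_closure_insert`), and finitely
many z_ν can be exchanged for generators of this kind (`approxBy_stage`, `approxBy_layer`). So
incompleteness holds at every limit δ for the monomials, and on a club for any other generating
sequence (`gammaEq_one_of_unrealized`). -/

set_option linter.unusedSectionVars false

/-! ### Hahn series with restricted coefficients, Gauss valuations and approximation -/

namespace HahnSeries

open Polynomial

variable {Γ K : Type*} [AddCommGroup Γ] [LinearOrder Γ] [IsOrderedAddMonoid Γ] [Field K]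

/-- The coefficientwise extension of a ring homomorphism to Hahn series. -/
noncomputable def mapCoeffHom {k : Type*} [Field k] (f : k →+* K) :
    HahnSeries Γ k →+* HahnSeries Γ K where
  toFun x := x.map f
  map_one' := by ext; simp [coeff_one, apply_ite f]
  map_mul' x y := HahnSeries.map_mul (f : k →ₙ+* K)
  map_zero' := by ext; simp
  map_add' x y := by ext; simp

/-- The subfield of the Hahn series all of whose coefficients lie in a given subfield. -/
noncomputable def coeffSubfield (Γ : Type*) [AddCommGroup Γ] [LinearOrder Γ] [IsOrderedAddMonoid Γ]
    (k : Subfield K) : Subfield (HahnSeries Γ K) :=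
  (mapCoeffHom (Γ := Γ) k.subtype).fieldRange

theorem mem_coeffSubfield {k : Subfield K} {x : HahnSeries Γ K} :
    x ∈ coeffSubfield Γ k ↔ ∀ g, x.coeff g ∈ k := by
  constructor
  · rintro ⟨y, rfl⟩ g
    exact (y.coeff g).2
  · intro h
    refine ⟨⟨fun g => ⟨x.coeff g, h g⟩, x.isPWO_support.mono ?_⟩, ?_⟩
    · intro g hg h0
      exact hg (Subtype.ext h0)
    · ext g
      rfl

theorem coeffSubfield_mono {k l : Subfield K} (h : k ≤ l) :
    coeffSubfield Γ k ≤ coeffSubfield Γ l := fun _ hx =>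
  mem_coeffSubfield.2 fun g => h (mem_coeffSubfield.1 hx g)

theorem single_mem_coeffSubfield {k : Subfield K} {g : Γ} {a : K} (ha : a ∈ k) :
    single g a ∈ coeffSubfield Γ k := by
  rw [mem_coeffSubfield]
  intro g'
  by_cases h : g' = g
  · subst h; simpa using ha
  · rw [coeff_single_of_ne h]; exact k.zero_mem

theorem single_one_ne_zero {g : Γ} : single g (1 : K) ≠ 0 := by simp

theorem orderTop_single_one (g : Γ) : (single g (1 : K)).orderTop = g := orderTop_single one_ne_zero

theorem single_one_mul_single_neg (g : Γ) : single g (1 : K) * single (-g) 1 = 1 := by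
  rw [single_mul_single]; simp

theorem orderTop_inv_add (x : HahnSeries Γ K) (hx : x ≠ 0) : x.orderTop + x⁻¹.orderTop = 0 := by
  rw [← orderTop_mul, mul_inv_cancel₀ hx, orderTop_one]

theorem orderTop_inv_eq_zero {x : HahnSeries Γ K} (hx : x.orderTop = 0) : x⁻¹.orderTop = 0 := by
  have h0 : x ≠ 0 := by rintro rfl; simp at hx
  simpa [hx] using orderTop_inv_add x h0

theorem le_orderTop_iff_coeff {x : HahnSeries Γ K} {g : Γ} :
    (g : WithTop Γ) ≤ x.orderTop ↔ ∀ i < g, x.coeff i = 0 := by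
  rw [le_orderTop_iff_forall]
  simp

theorem orderTop_eq_zero_iff {x : HahnSeries Γ K} :
    x.orderTop = 0 ↔ 0 ≤ x.orderTop ∧ x.coeff 0 ≠ 0 := by
  constructor
  · intro h
    exact ⟨h.ge, coeff_orderTop_ne h⟩
  · rintro ⟨h, h0⟩
    exact le_antisymm (orderTop_le_of_coeff_ne_zero h0) h

theorem le_orderTop_sub_trans {x y z : HahnSeries Γ K} {g : WithTop Γ}
    (h₁ : g ≤ (x - y).orderTop) (h₂ : g ≤ (y - z).orderTop) : g ≤ (x - z).orderTop := by
  have : x - z = (x - y) + (y - z) := by ring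
  rw [this]
  exact (le_min h₁ h₂).trans min_orderTop_le_orderTop_add

theorem orderTop_sub_comm (x y : HahnSeries Γ K) : (x - y).orderTop = (y - x).orderTop := by
  rw [← orderTop_neg, neg_sub]

theorem le_orderTop_mul_left {x y : HahnSeries Γ K} {g : WithTop Γ} (hx : 0 ≤ x.orderTop)
    (hy : g ≤ y.orderTop) : g ≤ (x * y).orderTop := by
  rw [orderTop_mul]
  exact hy.trans (le_add_of_nonneg_left hx)

theorem coeff_zero_mul {a b : HahnSeries Γ K} (ha : 0 ≤ a.orderTop) (hb : 0 ≤ b.orderTop) :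
    (a * b).coeff 0 = a.coeff 0 * b.coeff 0 := by
  have key : ∀ x : HahnSeries Γ K, 0 ≤ x.orderTop → 0 < (x - C (x.coeff 0)).orderTop := by
    intro x hx
    by_contra! hlt
    have h1 : 0 ≤ (x - C (x.coeff 0)).orderTop := by
      refine le_trans (le_min hx ?_) min_orderTop_le_orderTop_sub
      exact orderTop_single_le (a := (0 : Γ))
    have := (orderTop_eq_zero_iff.1 (le_antisymm hlt h1)).2
    simp [C_apply] at this
  have e : a * b = (a - C (a.coeff 0)) * b + C (a.coeff 0) * b := by ring
  have h0 : ((a - C (a.coeff 0)) * b).coeff 0 = 0 := by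
    apply coeff_eq_zero_of_lt_orderTop
    rw [orderTop_mul]
    exact add_pos_of_pos_of_nonneg (key a ha) hb
  rw [e, coeff_add, h0, zero_add, C_apply, coeff_single_zero_mul]

theorem orderTop_pow_nonneg {a : HahnSeries Γ K} (ha : 0 ≤ a.orderTop) (n : ℕ) :
    0 ≤ (a ^ n).orderTop := by
  induction n with
  | zero => simp
  | succ n ih => rw [pow_succ, orderTop_mul]; exact add_nonneg ih ha

theorem coeff_zero_pow {a : HahnSeries Γ K} (ha : 0 ≤ a.orderTop) (n : ℕ) :
    (a ^ n).coeff 0 = a.coeff 0 ^ n := by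
  induction n with
  | zero => simp
  | succ n ih => rw [pow_succ, coeff_zero_mul (orderTop_pow_nonneg ha n) ha, ih, pow_succ]

theorem le_orderTop_sum {ι : Type*} (s : Finset ι) (f : ι → HahnSeries Γ K) {g : WithTop Γ}
    (h : ∀ i ∈ s, g ≤ (f i).orderTop) : g ≤ (∑ i ∈ s, f i).orderTop := by
  classical
  induction s using Finset.induction_on with
  | empty => simp
  | insert a s ha ih =>
    rw [Finset.sum_insert ha]
    refine le_trans (le_min (h a (by simp)) (ih fun i hi => h i (by simp [hi])))
      min_orderTop_le_orderTop_add

theorem le_orderTop_eval {P : (HahnSeries Γ K)[X]} {Z : HahnSeries Γ K} (hZ : 0 ≤ Z.orderTop)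
    {g : WithTop Γ} (h : ∀ i, g ≤ (P.coeff i).orderTop) : g ≤ (P.eval Z).orderTop := by
  rw [eval_eq_sum_range]
  refine le_orderTop_sum _ _ fun i _ => ?_
  rw [mul_comm]
  exact le_orderTop_mul_left (orderTop_pow_nonneg hZ i) (h i)

/-- A polynomial with coefficients over `k` has Gauss valuation at an element whose residue is
transcendental over `k`. -/
theorem orderTop_eval_le {k : Subfield K} {P : (HahnSeries Γ K)[X]}
    (hP : ∀ i, P.coeff i ∈ coeffSubfield Γ k) {Z : HahnSeries Γ K} (hZ : 0 ≤ Z.orderTop)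
    (htr : Transcendental k (Z.coeff 0)) (i : ℕ) :
    (P.eval Z).orderTop ≤ (P.coeff i).orderTop := by
  by_cases hP0 : P = 0
  · simp [hP0]
  obtain ⟨j, hj, hmin⟩ := P.support.exists_min_image (fun i => (P.coeff i).orderTop)
    (by simpa [Finset.nonempty_iff_ne_empty] using hP0)
  have hmin' : ∀ i, (P.coeff j).orderTop ≤ (P.coeff i).orderTop := by
    intro i
    by_cases hi : i ∈ P.support
    · exact hmin i hi
    · rw [notMem_support_iff.1 hi]; simp
  refine le_trans ?_ (hmin' i)
  have hj0 : P.coeff j ≠ 0 := by simpa using hj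
  obtain ⟨g, hg⟩ := WithTop.ne_top_iff_exists.1 (orderTop_ne_top.2 hj0)
  rw [← hg]
  set Q : (HahnSeries Γ K)[X] := Polynomial.C (single (-g) 1) * P with hQ
  have hQi : ∀ i, 0 ≤ (Q.coeff i).orderTop := by
    intro i
    rw [hQ, Polynomial.coeff_C_mul, orderTop_mul, orderTop_single_one]
    have := hmin' i
    rw [← hg] at this
    calc (0 : WithTop Γ) = ((-g : Γ) : WithTop Γ) + (g : WithTop Γ) := by
          rw [← WithTop.coe_add]; simp
      _ ≤ _ := by gcongr
  have hQj : (Q.coeff j).orderTop = 0 := by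
    rw [hQ, Polynomial.coeff_C_mul, orderTop_mul, orderTop_single_one, ← hg, ← WithTop.coe_add]
    simp
  have hQk : ∀ i, (Q.coeff i).coeff 0 ∈ k := by
    intro i
    refine mem_coeffSubfield.1 ?_ 0
    rw [hQ, Polynomial.coeff_C_mul]
    exact mul_mem (single_mem_coeffSubfield k.one_mem) (hP i)
  let q : k[X] := ∑ i ∈ Finset.range (Q.natDegree + 1), Polynomial.monomial i ⟨_, hQk i⟩
  have hq : aeval (Z.coeff 0) q = (Q.eval Z).coeff 0 := by
    rw [eval_eq_sum_range, coeff_sum, map_sum]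
    refine Finset.sum_congr rfl fun i _ => ?_
    rw [coeff_zero_mul (hQi i) (orderTop_pow_nonneg hZ i), coeff_zero_pow hZ, aeval_monomial]
    rfl
  have hq0 : q ≠ 0 := by
    intro h
    have hjq : q.coeff j = 0 := by rw [h]; simp
    have hne := (orderTop_eq_zero_iff.1 hQj).2
    have hjr : j ∈ Finset.range (Q.natDegree + 1) := by
      rw [Finset.mem_range, Nat.lt_succ_iff]
      apply le_natDegree_of_ne_zero
      intro h0
      rw [h0] at hne; simp at hne
    rw [finsetSum_coeff] at hjq
    simp only [Polynomial.coeff_monomial] at hjq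
    rw [Finset.sum_ite_eq_of_mem' _ _ _ hjr] at hjq
    exact hne (congrArg Subtype.val hjq)
  have hne : (Q.eval Z).coeff 0 ≠ 0 := by
    rw [← hq]
    intro h
    exact hq0 ((transcendental_iff.1 htr) q h)
  have hle := orderTop_le_of_coeff_ne_zero hne
  rw [hQ, eval_mul, eval_C, orderTop_mul, orderTop_single_one] at hle
  calc (P.eval Z).orderTop = ((g : WithTop Γ) + ((-g : Γ) : WithTop Γ)) + (P.eval Z).orderTop := by
        rw [← WithTop.coe_add]; simp
    _ = (g : WithTop Γ) + (((-g : Γ) : WithTop Γ) + (P.eval Z).orderTop) := add_assoc _ _ _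
    _ ≤ (g : WithTop Γ) + ((0 : Γ) : WithTop Γ) := by gcongr
    _ = g := by rw [← WithTop.coe_add]; simp

/-- `F` approximates series over `k` as well as the extension `E` does. -/
def ApproxBy (k : Subfield K) (F E : Subfield (HahnSeries Γ K)) : Prop :=
  ∀ f ∈ E, ∀ w ∈ coeffSubfield Γ k, ∃ g ∈ F, (w - f).orderTop ≤ (w - g).orderTop

theorem ApproxBy.trans {k l : Subfield K} {F E D : Subfield (HahnSeries Γ K)} (hkl : k ≤ l)
    (h₁ : ApproxBy k F E) (h₂ : ApproxBy l E D) : ApproxBy k F D := by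
  intro f hf w hw
  obtain ⟨g, hg, h⟩ := h₂ f hf w (coeffSubfield_mono hkl hw)
  obtain ⟨g', hg', h'⟩ := h₁ g hg w hw
  exact ⟨g', hg', h.trans h'⟩

/-- An element of F(Z) is P(Z)/Q(Z). By `orderTop_eval_le`, Q(Z) has the least order of the
coefficients of Q, attained at some index j, while (wQ - P)(Z) has order at most that of the j-th
coefficient of wQ - P. Dividing, P_j/Q_j ∈ F is at least as close to w. -/
theorem approxBy_closure_insert {k : Subfield K} {F : Subfield (HahnSeries Γ K)}
    (hF : F ≤ coeffSubfield Γ k) {Z : HahnSeries Γ K} (hZ : 0 ≤ Z.orderTop)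
    (htr : Transcendental k (Z.coeff 0)) :
    ApproxBy k F (Subfield.closure (insert Z (F : Set (HahnSeries Γ K)))) := by
  intro f hf w hw
  have hf' : f ∈ IntermediateField.adjoin F {Z} := by
    change f ∈ Subfield.closure _
    refine Subfield.closure_mono ?_ hf
    rintro x (rfl | hx)
    · exact Or.inr rfl
    · exact Or.inl ⟨⟨x, hx⟩, rfl⟩
  obtain ⟨p, q, rfl⟩ := (IntermediateField.mem_adjoin_simple_iff F f).1 hf'
  have hq' : ∀ q : F[X], aeval Z q = (q.map (algebraMap F (HahnSeries Γ K))).eval Z := by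
    intro q; rw [eval_map, aeval_def]
  have hmem : ∀ (q : F[X]) (i : ℕ),
      (q.map (algebraMap F (HahnSeries Γ K))).coeff i ∈ F := by
    intro q i; rw [Polynomial.coeff_map]; exact (q.coeff i).2
  set P := p.map (algebraMap F (HahnSeries Γ K)) with hPdef
  set Q := q.map (algebraMap F (HahnSeries Γ K)) with hQdef
  rw [hq' p, hq' q]
  -- Here the quotient is 0 by the convention for division by zero.
  by_cases hQZ : Q.eval Z = 0
  · exact ⟨0, F.zero_mem, by rw [hQZ]; simp⟩
  have hQ0 : Q ≠ 0 := by rintro h; rw [h] at hQZ; simp at hQZ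
  obtain ⟨j, hj, hmin⟩ := Q.support.exists_min_image (fun i => (Q.coeff i).orderTop)
    (by simpa [Finset.nonempty_iff_ne_empty] using hQ0)
  have hj0 : Q.coeff j ≠ 0 := by simpa using hj
  have hmin' : ∀ i, (Q.coeff j).orderTop ≤ (Q.coeff i).orderTop := by
    intro i
    by_cases hi : i ∈ Q.support
    · exact hmin i hi
    · rw [notMem_support_iff.1 hi]; simp
  have hQval : (Q.eval Z).orderTop = (Q.coeff j).orderTop :=
    le_antisymm (orderTop_eval_le (fun i => hF (hmem q i)) hZ htr j) (le_orderTop_eval hZ hmin')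
  refine ⟨P.coeff j / Q.coeff j, div_mem (hmem p j) (hmem q j), ?_⟩
  have h1 : ((Polynomial.C w * Q - P).eval Z).orderTop ≤ (w * Q.coeff j - P.coeff j).orderTop := by
    have := orderTop_eval_le (P := Polynomial.C w * Q - P) (k := k) (fun i => by
      rw [Polynomial.coeff_sub, Polynomial.coeff_C_mul]
      exact sub_mem (mul_mem hw (hF (hmem q i))) (hF (hmem p i))) hZ htr j
    rwa [Polynomial.coeff_sub, Polynomial.coeff_C_mul] at this
  have e1 : (Polynomial.C w * Q - P).eval Z = (w - P.eval Z / Q.eval Z) * Q.eval Z := by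
    rw [eval_sub, eval_mul, eval_C]; field_simp
  have e2 : w * Q.coeff j - P.coeff j = (w - P.coeff j / Q.coeff j) * Q.coeff j := by
    field_simp
  rw [e1, e2, orderTop_mul, orderTop_mul, hQval] at h1
  exact (WithTop.add_le_add_iff_right (orderTop_ne_top.2 hj0)).1 h1

end HahnSeries

/-! ### Limits of pseudo-Cauchy families and trivialization of cocycles -/

namespace HahnSeries

variable {Γ K W : Type*} [AddCommGroup Γ] [LinearOrder Γ] [IsOrderedAddMonoid Γ] [Field K]
  [LinearOrder W]

/-- The coefficient at an exponent g is the same in all `a μ` with g < γ μ; the limit takes this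
value, and 0 if there is no such μ. The last clause keeps the coefficients of the limit in any
subfield containing those of the family. -/
theorem exists_limit {γ : W → Γ} {s : Set W} {a : W → HahnSeries Γ K}
    (ha : ∀ μ ∈ s, ∀ ν ∈ s, μ < ν → (γ μ : WithTop Γ) ≤ (a μ - a ν).orderTop) :
    ∃ b : HahnSeries Γ K, (∀ μ ∈ s, (γ μ : WithTop Γ) ≤ (a μ - b).orderTop) ∧
      ∀ g, b.coeff g = 0 ∨ ∃ μ ∈ s, b.coeff g = (a μ).coeff g := by
  classical
  let f : Γ → K := fun g => if h : ∃ μ ∈ s, g < γ μ then (a h.choose).coeff g else 0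
  have hf : ∀ μ ∈ s, ∀ g < γ μ, f g = (a μ).coeff g := by
    intro μ hμ g hg
    have h : ∃ μ ∈ s, g < γ μ := ⟨μ, hμ, hg⟩
    have key : ∀ μ ∈ s, ∀ ν ∈ s, μ < ν → g < γ μ → (a μ).coeff g = (a ν).coeff g := by
      intro μ hμ ν hν h hg
      have := le_orderTop_iff_coeff.1 (ha μ hμ ν hν h) g hg
      rwa [coeff_sub, sub_eq_zero] at this
    simp only [f, dif_pos h]
    rcases lt_trichotomy h.choose μ with h' | h' | h'
    · exact key _ h.choose_spec.1 _ hμ h' h.choose_spec.2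
    · rw [h']
    · exact (key _ hμ _ h.choose_spec.1 h' hg).symm
  -- A descending sequence in the support stays below the `γ μ` that bounds its first term, so it
  -- lies in the support of the single series `a μ`.
  have hsupp : (Function.support f).IsPWO := by
    intro x
    by_contra hcon
    have hlt : ∀ m n, m < n → (x n : Γ) < x m := fun m n hmn => by
      by_contra hle
      exact hcon ⟨m, n, hmn, not_lt.1 hle⟩
    obtain ⟨μ, hμ, hxμ⟩ : ∃ μ ∈ s, (x 0 : Γ) < γ μ := by
      by_contra hn
      exact (x 0).2 (dif_neg hn)
    have hxn : ∀ n, (x n : Γ) < γ μ := by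
      intro n
      rcases Nat.eq_zero_or_pos n with rfl | hn
      · exact hxμ
      · exact (hlt 0 n hn).trans hxμ
    have hxs : ∀ n, (x n : Γ) ∈ (a μ).support := fun n => by
      have := (x n).2
      rwa [Function.mem_support, hf μ hμ _ (hxn n)] at this
    obtain ⟨m, n, hmn, hle⟩ := (a μ).isPWO_support fun n => ⟨x n, hxs n⟩
    exact (hlt m n hmn).not_ge hle
  refine ⟨⟨f, hsupp⟩, ?_, ?_⟩
  · intro μ hμ
    rw [le_orderTop_iff_coeff]
    intro i hi
    rw [coeff_sub, sub_eq_zero]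
    exact (hf μ hμ i hi).symm
  · intro g
    by_cases h : ∃ μ ∈ s, g < γ μ
    · exact Or.inr ⟨_, h.choose_spec.1, dif_pos h⟩
    · exact Or.inl (dif_neg h)

/-- Multiplicative cocycles for the inverse system of unit groups modulo the powers `γ μ`. -/
structure IsCocycle (γ : W → Γ) (e : W → W → HahnSeries Γ K) : Prop where
  unit : ∀ μ ν, μ < ν → (e μ ν).orderTop = 0
  mul : ∀ μ ν τ, μ < ν → ν < τ → (γ μ : WithTop Γ) ≤ (e μ ν * e ν τ - e μ τ).orderTop

/-- Cocycles of units over a full ring of Hahn series are coboundaries. -/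
theorem IsCocycle.exists_trivialization [WellFoundedLT W] {γ : W → Γ}
    (hpos : ∀ μ, 0 < γ μ) {e : W → W → HahnSeries Γ K} (he : IsCocycle γ e) {k : Subfield K}
    (hk : ∀ μ ν, μ < ν → e μ ν ∈ coeffSubfield Γ k) :
    ∃ c : W → HahnSeries Γ K, (∀ ν, (c ν).orderTop = 0) ∧ (∀ ν, c ν ∈ coeffSubfield Γ k) ∧
      ∀ μ ν, μ < ν → (γ μ : WithTop Γ) ≤ (c μ * e μ ν - c ν).orderTop := by
  classical
  -- `P ν prev b` says that `b` is admissible at `ν` given the earlier values. The default 0 in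
  -- `step` is never taken: `main` shows by induction that an admissible value exists.
  let P : ∀ ν : W, (∀ μ, μ < ν → HahnSeries Γ K) → HahnSeries Γ K → Prop := fun ν prev b =>
    b.orderTop = 0 ∧ b ∈ coeffSubfield Γ k ∧
      ∀ μ (h : μ < ν), (γ μ : WithTop Γ) ≤ (prev μ h * e μ ν - b).orderTop
  let step : ∀ ν : W, (∀ μ, μ < ν → HahnSeries Γ K) → HahnSeries Γ K := fun ν prev =>
    if h : ∃ b, P ν prev b then h.choose else 0
  let c : W → HahnSeries Γ K := (wellFounded_lt (α := W)).fix step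
  have hc : ∀ ν, c ν = step ν (fun μ _ => c μ) := fun ν => WellFounded.fix_eq _ _ _
  have main : ∀ ν, P ν (fun μ _ => c μ) (c ν) := by
    intro ν
    induction ν using WellFoundedLT.induction with
    | ind ν ih =>
    suffices h : ∃ b, P ν (fun μ _ => c μ) b by
      rw [hc ν]
      simp only [step, dif_pos h]
      exact h.choose_spec
    -- For μ < μ' both terms agree with c_μ e_μμ' e_μ'ν up to order γ μ.
    have hcomp : ∀ μ ∈ Set.Iio ν, ∀ μ' ∈ Set.Iio ν, μ < μ' →
        (γ μ : WithTop Γ) ≤ (c μ * e μ ν - c μ' * e μ' ν).orderTop := by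
      intro μ hμ μ' hμ' h
      have h1 := he.mul μ μ' ν h hμ'
      have h2 := (ih μ' hμ').2.2 μ h
      refine le_orderTop_sub_trans (y := c μ * e μ μ' * e μ' ν) ?_ ?_
      · rw [orderTop_sub_comm, mul_assoc, ← mul_sub]
        exact le_orderTop_mul_left (ih μ hμ).1.ge h1
      · rw [← sub_mul, mul_comm]
        exact le_orderTop_mul_left (he.unit μ' ν hμ').ge h2
    -- At the least index the family is empty and its limit need not be a unit, so 1 is taken
    -- instead.
    by_cases hν : ∃ μ, μ < ν
    · obtain ⟨b, hb1, hb2⟩ := exists_limit hcomp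
      obtain ⟨μ, hμ⟩ := hν
      refine ⟨b, ?_, ?_, hb1⟩
      · have h0 : (c μ * e μ ν).orderTop = 0 := by
          rw [orderTop_mul, (ih μ hμ).1, he.unit μ ν hμ, add_zero]
        have hlt : (c μ * e μ ν).orderTop < (b - c μ * e μ ν).orderTop := by
          rw [h0, orderTop_sub_comm]
          exact lt_of_lt_of_le (by exact_mod_cast hpos μ) (hb1 μ hμ)
        have := orderTop_add_eq_left hlt
        rwa [add_sub_cancel, h0] at this
      · rw [mem_coeffSubfield]
        intro g
        rcases hb2 g with h | ⟨μ, hμ, h⟩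
        · rw [h]; exact k.zero_mem
        · rw [h]
          exact mem_coeffSubfield.1 (mul_mem (ih μ hμ).2.1 (hk μ ν hμ)) g
    · exact ⟨1, orderTop_one, one_mem _, fun μ h => (hν ⟨μ, h⟩).elim⟩
  exact ⟨c, fun ν => (main ν).1, fun ν => (main ν).2.1, fun μ ν h => (main ν).2.2 μ h⟩

end HahnSeries

/-! ### The iterated generic extension -/

namespace GenericHahn

open HahnSeries

/-- Variables: `(false, _, _)` are constants of the base field, `(true, α, _)` are used at stage
`α`. -/
abbrev Var (I W : Type*) := Bool × I × Option W

/-- The rational function field in the variables. -/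
def CoeffField (I W : Type*) := FractionRing (MvPolynomial (Var I W) ℚ)

noncomputable instance (I W : Type*) : Field (CoeffField I W) :=
  inferInstanceAs (Field (FractionRing (MvPolynomial (Var I W) ℚ)))

noncomputable instance (I W : Type*) : Algebra (MvPolynomial (Var I W) ℚ) (CoeffField I W) :=
  inferInstanceAs (Algebra _ (FractionRing (MvPolynomial (Var I W) ℚ)))

instance (I W : Type*) : IsFractionRing (MvPolynomial (Var I W) ℚ) (CoeffField I W) :=
  inferInstanceAs (IsFractionRing _ (FractionRing (MvPolynomial (Var I W) ℚ)))

instance (I W : Type*) : CharZero (CoeffField I W) :=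
  charZero_of_injective_algebraMap (IsFractionRing.injective (MvPolynomial (Var I W) ℚ) _)

section Coefficients

variable {I W : Type*}

/-- The variables as elements of the rational function field. -/
noncomputable def gen (v : Var I W) : CoeffField I W :=
  algebraMap (MvPolynomial (Var I W) ℚ) _ (MvPolynomial.X v)

/-- The subfield generated by the variables in `S`. -/
noncomputable def varField (S : Set (Var I W)) : Subfield (CoeffField I W) :=
  (IntermediateField.adjoin ℚ (gen '' S)).toSubfield

theorem algebraicIndependent_gen : AlgebraicIndependent ℚ (gen : Var I W → CoeffField I W) := by
  have h := MvPolynomial.algebraicIndependent_X (Var I W) ℚ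
  exact h.map' (f := IsScalarTower.toAlgHom ℚ (MvPolynomial (Var I W) ℚ) (CoeffField I W))
    (IsFractionRing.injective (MvPolynomial (Var I W) ℚ) (CoeffField I W))

theorem transcendental_gen {S : Set (Var I W)} {v : Var I W} (hv : v ∉ S) :
    Transcendental (varField S) (gen v) := by
  have h := algebraicIndependent_gen.transcendental_adjoin hv
  exact IntermediateField.transcendental_adjoin_iff.2 h

theorem transcendental_add_mul_gen {S : Set (Var I W)} {v : Var I W} (hv : v ∉ S)
    {a b : CoeffField I W} (ha : a ∈ varField S) (ha0 : a ≠ 0) (hb : b ∈ varField S) :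
    Transcendental (varField S) (gen v * a + b) := by
  intro h
  apply transcendental_gen hv
  have hb' : IsAlgebraic (varField S) b := isAlgebraic_algebraMap (⟨b, hb⟩ : varField S)
  have ha' : IsAlgebraic (varField S) a := isAlgebraic_algebraMap (⟨a, ha⟩ : varField S)
  have : gen v = (gen v * a + b - b) * a⁻¹ := by field_simp; ring
  rw [this]
  exact (h.sub hb').mul ha'.inv

theorem gen_mem_varField {S : Set (Var I W)} {v : Var I W} (hv : v ∈ S) : gen v ∈ varField S :=
  IntermediateField.subset_adjoin _ _ ⟨v, hv, rfl⟩

theorem gen_notMem_varField {S : Set (Var I W)} {v : Var I W} (hv : v ∉ S) :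
    gen v ∉ varField S := fun h =>
  transcendental_gen hv (isAlgebraic_algebraMap (⟨_, h⟩ : varField S))

theorem varField_mono {S T : Set (Var I W)} (h : S ⊆ T) : varField S ≤ varField T :=
  IntermediateField.adjoin.mono ℚ _ _ (Set.image_mono h)

theorem gen_injective : Function.Injective (gen : Var I W → CoeffField I W) :=
  algebraicIndependent_gen.injective

theorem gen_ne_zero (v : Var I W) : gen v ≠ 0 := algebraicIndependent_gen.ne_zero v

end Coefficients

variable {Γ I W : Type*} [AddCommGroup Γ] [LinearOrder Γ] [IsOrderedAddMonoid Γ]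
  [LinearOrder W] [WellFoundedLT W] [LinearOrder I] [WellFoundedLT I]

variable (Γ I W) in
/-- The field of Hahn series in which everything takes place. -/
abbrev Series := HahnSeries Γ (CoeffField I W)

variable (I W) in
/-- The variables of the base field. -/
def baseVars : Set (Var I W) := {v | v.1 = false}

variable (W) in
/-- The variables used before stage `α`. -/
def varsBefore (α : I) : Set (Var I W) := {v | v.1 = true → v.2.1 < α}

theorem baseVars_subset (α : I) : baseVars I W ⊆ varsBefore W α := by
  intro v hv h
  rw [baseVars, Set.mem_ofPred_eq] at hv
  simp [hv] at h

variable (Γ I W) in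
/-- Generators of the base field: monomials and constants. -/
def baseGens : Set (Series Γ I W) :=
  Set.range (fun g => single g 1) ∪ (fun v => C (gen v)) '' baseVars I W

/-- Series trivializing the cocycle `e` over the variables used before stage `α`, if there are
any. -/
noncomputable def trivialization (γ : W → Γ) (e : W → W → Series Γ I W) (α : I) :
    W → Series Γ I W := by
  classical exact
  if h : ∃ c : W → Series Γ I W, (∀ ν, (c ν).orderTop = 0) ∧
    (∀ ν, c ν ∈ coeffSubfield Γ (varField (varsBefore W α))) ∧
    ∀ μ ν, μ < ν → (γ μ : WithTop Γ) ≤ (c μ * e μ ν - c ν).orderTop then h.choose else 0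

/-- The generic perturbation of the trivialization of `e`. -/
noncomputable def genericUnit (γ : W → Γ) (e : W → W → Series Γ I W) (α : I) (ν : W) :
    Series Γ I W :=
  C (gen (true, α, none)) * trivialization γ e α ν + single (γ ν) (gen (true, α, some ν))

/-- The stages at which generators are adjoined: those `α` for which `e α` is a cocycle with values
in the field constructed before stage `α`. -/
noncomputable def Good (γ : W → Γ) (e : I → W → W → Series Γ I W) : I → Prop :=
  -- The field built before stage α is written out because `layer` itself refers to `Good`;
  -- `good_iff` folds it back.
  (wellFounded_lt (α := I)).fix fun α rec => IsCocycle γ (e α) ∧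
    ∀ μ ν, e α μ ν ∈ Subfield.closure (baseGens Γ I W ∪
      {x | ∃ β, ∃ h : β < α, rec β h ∧ ∃ ν, genericUnit γ (e β) β ν = x})

/-- The field generated over the base field by what is adjoined at the stages in `A`. -/
noncomputable def layer (γ : W → Γ) (e : I → W → W → Series Γ I W) (A : Set I) : Subfield (Series Γ I W) :=
  Subfield.closure (baseGens Γ I W ∪
    {x | ∃ β ∈ A, Good γ e β ∧ ∃ ν, genericUnit γ (e β) β ν = x})

variable {γ : W → Γ} {e : I → W → W → Series Γ I W}

theorem good_iff (α : I) : Good γ e α ↔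
    IsCocycle γ (e α) ∧ ∀ μ ν, e α μ ν ∈ layer γ e (Set.Iio α) := by
  rw [Good, WellFounded.fix_eq]
  simp only [layer, Set.mem_Iio, exists_prop]
  exact Iff.rfl

theorem layer_mono {A B : Set I} (h : A ⊆ B) : layer γ e A ≤ layer γ e B := by
  apply Subfield.closure_mono
  apply Set.union_subset_union_right
  rintro x ⟨β, hβ, hx⟩
  exact ⟨β, h hβ, hx⟩

theorem single_mem_layer (A : Set I) (g : Γ) : single g 1 ∈ layer γ e A :=
  Subfield.subset_closure (Or.inl (Or.inl ⟨g, rfl⟩))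

theorem C_gen_mem_layer (A : Set I) {v : Var I W} (hv : v ∈ baseVars I W) :
    C (gen v) ∈ layer γ e A :=
  Subfield.subset_closure (Or.inl (Or.inr ⟨v, hv, rfl⟩))

theorem genericUnit_mem_layer {A : Set I} {β : I} (hβ : β ∈ A) (hg : Good γ e β) (ν : W) :
    genericUnit γ (e β) β ν ∈ layer γ e A :=
  Subfield.subset_closure (Or.inr ⟨β, hβ, hg, ν, rfl⟩)

/-- The inclusion `h` is kept as a hypothesis because its proof, `layer_Iio_le`, is an induction
that applies this lemma at earlier stages. -/
theorem trivialization_spec_of_le (hpos : ∀ μ, 0 < γ μ) {α : I} (hα : Good γ e α)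
    (h : layer γ e (Set.Iio α) ≤ coeffSubfield Γ (varField (varsBefore W α))) :
    (∀ ν, (trivialization γ (e α) α ν).orderTop = 0) ∧
    (∀ ν, trivialization γ (e α) α ν ∈ coeffSubfield Γ (varField (varsBefore W α))) ∧
    ∀ μ ν, μ < ν → (γ μ : WithTop Γ) ≤
      (trivialization γ (e α) α μ * e α μ ν - trivialization γ (e α) α ν).orderTop := by
  rw [good_iff] at hα
  have := hα.1.exists_trivialization hpos fun μ ν _ => h (hα.2 μ ν)
  simp only [trivialization, dif_pos this]
  exact this.choose_spec

/-- The variables used before stage `α`, and those of the `ν`-th generators at stage `α` for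
`ν ∈ T`. -/
def varsUpTo (α : I) (T : Set W) : Set (Var I W) :=
  varsBefore W α ∪ {(true, α, none)} ∪ (fun ν => (true, α, some ν)) '' T

theorem varsBefore_subset_varsUpTo (α : I) (T : Set W) : varsBefore W α ⊆ varsUpTo α T :=
  fun _ h => Or.inl (Or.inl h)

theorem varsUpTo_subset_varsBefore {α β : I} (h : β < α) (T : Set W) :
    varsUpTo β T ⊆ varsBefore W α := by
  rintro v ((hv | rfl) | ⟨ν, -, rfl⟩) hv'
  · exact (hv hv').trans h
  · exact h
  · exact h

theorem genericUnit_mem_of_mem {k : Subfield (CoeffField I W)} {α : I} {ν : W}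
    (hc : trivialization γ (e α) α ν ∈ coeffSubfield Γ k) (hx : gen (true, α, none) ∈ k)
    (hy : gen (true, α, some ν) ∈ k) : genericUnit γ (e α) α ν ∈ coeffSubfield Γ k :=
  add_mem (mul_mem (single_mem_coeffSubfield hx) hc) (single_mem_coeffSubfield hy)

theorem baseGens_subset (S : Set (Var I W)) (hS : baseVars I W ⊆ S) :
    baseGens Γ I W ⊆ coeffSubfield Γ (varField S) := by
  rintro _ (⟨g, rfl⟩ | ⟨v, hv, rfl⟩)
  · exact single_mem_coeffSubfield (one_mem _)
  · exact single_mem_coeffSubfield (gen_mem_varField (hS hv))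

theorem layer_Iio_le (hpos : ∀ μ, 0 < γ μ) (α : I) :
    layer γ e (Set.Iio α) ≤ coeffSubfield Γ (varField (varsBefore W α)) := by
  induction α using WellFoundedLT.induction with
  | ind α ih =>
  rw [layer, Subfield.closure_le]
  apply Set.union_subset (baseGens_subset _ (baseVars_subset α))
  rintro _ ⟨β, hβ, hg, ν, rfl⟩
  have hc := (trivialization_spec_of_le hpos hg (ih β hβ)).2.1 ν
  refine coeffSubfield_mono (varField_mono (varsUpTo_subset_varsBefore hβ {ν})) ?_
  refine genericUnit_mem_of_mem
    (coeffSubfield_mono (varField_mono (varsBefore_subset_varsUpTo _ _)) hc) ?_ ?_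
  · exact gen_mem_varField (Or.inl (Or.inr rfl))
  · exact gen_mem_varField (Or.inr ⟨ν, rfl, rfl⟩)

/-! ### A single stage of the construction -/

section Stage

variable (hpos : ∀ μ, 0 < γ μ) (hmono : StrictMono γ) {α : I} (hα : Good γ e α)

include hpos hα

theorem orderTop_trivialization (ν : W) : (trivialization γ (e α) α ν).orderTop = 0 :=
  (trivialization_spec_of_le hpos hα (layer_Iio_le hpos α)).1 ν

theorem trivialization_mem (ν : W) :
    trivialization γ (e α) α ν ∈ coeffSubfield Γ (varField (varsBefore W α)) :=
  (trivialization_spec_of_le hpos hα (layer_Iio_le hpos α)).2.1 ν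

theorem le_orderTop_trivialization {μ ν : W} (h : μ < ν) : (γ μ : WithTop Γ) ≤
    (trivialization γ (e α) α μ * e α μ ν - trivialization γ (e α) α ν).orderTop :=
  (trivialization_spec_of_le hpos hα (layer_Iio_le hpos α)).2.2 μ ν h

theorem orderTop_genericUnit (ν : W) : (genericUnit γ (e α) α ν).orderTop = 0 := by
  have h1 : (C (gen (true, α, none)) * trivialization γ (e α) α ν).orderTop = 0 := by
    rw [orderTop_mul, orderTop_trivialization hpos hα, C_apply, orderTop_single (gen_ne_zero _)]
    simp
  rw [genericUnit, orderTop_add_eq_left, h1]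
  rw [h1, orderTop_single (gen_ne_zero _)]
  exact_mod_cast hpos ν

include hmono in
/-- The generic units trivialize the cocycle. -/
theorem le_orderTop_genericUnit {μ ν : W} (h : μ < ν) : (γ μ : WithTop Γ) ≤
    (genericUnit γ (e α) α μ * e α μ ν - genericUnit γ (e α) α ν).orderTop := by
  -- The error is x times the error of c, plus two perturbation terms of orders at least γ μ and γ
  -- ν.
  have e1 : genericUnit γ (e α) α μ * e α μ ν - genericUnit γ (e α) α ν =
      (C (gen (true, α, none)) *
        (trivialization γ (e α) α μ * e α μ ν - trivialization γ (e α) α ν) +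
      e α μ ν * single (γ μ) (gen (true, α, some μ))) -
      single (γ ν) (gen (true, α, some ν)) := by
    simp only [genericUnit]; ring
  rw [e1]
  refine le_trans (le_min (le_trans (le_min ?_ ?_) min_orderTop_le_orderTop_add) ?_)
    min_orderTop_le_orderTop_sub
  · refine le_orderTop_mul_left ?_ (le_orderTop_trivialization hpos hα h)
    exact orderTop_single_le (a := (0 : Γ))
  · refine le_orderTop_mul_left ?_ orderTop_single_le
    exact (((good_iff α).1 hα).1.unit μ ν h).ge
  · exact le_trans (by exact_mod_cast (hmono h).le) orderTop_single_le

theorem genericUnit_mem {T : Set W} {ν : W} (hν : ν ∈ T) :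
    genericUnit γ (e α) α ν ∈ coeffSubfield Γ (varField (varsUpTo α T)) :=
  genericUnit_mem_of_mem (coeffSubfield_mono (varField_mono (varsBefore_subset_varsUpTo _ _))
    (trivialization_mem hpos hα ν)) (gen_mem_varField (Or.inl (Or.inr rfl)))
    (gen_mem_varField (Or.inr ⟨ν, hν, rfl⟩))

theorem closure_le_varsUpTo (T : Set W) :
    Subfield.closure (layer γ e (Set.Iio α) ∪ genericUnit γ (e α) α '' T) ≤
      coeffSubfield Γ (varField (varsUpTo α T)) := by
  rw [Subfield.closure_le]
  apply Set.union_subset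
  · exact (layer_Iio_le hpos α).trans
      (coeffSubfield_mono (varField_mono (varsBefore_subset_varsUpTo _ _)))
  · rintro _ ⟨ν, hν, rfl⟩
    exact genericUnit_mem hpos hα hν

include hmono in
-- Modulo high powers the z_ν are multiples of one another, so they are not generic individually.
-- Adjoined from the largest index downwards and corrected by the part already present, each
-- contributes a residue containing a new variable, and `approxBy_closure_insert` applies step by
-- step.
theorem approxBy_stage [DecidableEq W] (T : Finset W) :
    ApproxBy (varField (varsBefore W α)) (layer γ e (Set.Iio α))
      (Subfield.closure (layer γ e (Set.Iio α) ∪ genericUnit γ (e α) α '' T)) := by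
  induction T using Finset.induction_on_min with
  | empty =>
    intro f hf w _
    refine ⟨f, ?_, le_rfl⟩
    simpa using hf
  | insert ν T hν ih =>
    have hc0 : (single (γ ν) (gen (true, α, some ν)) : Series Γ I W).coeff 0 = 0 :=
      coeff_single_of_ne (hpos ν).ne
    -- The first generator has residue x times the non-zero residue of c_ν, and x is new.
    rcases T.eq_empty_or_nonempty with rfl | ⟨τ, hτ⟩
    · have := approxBy_closure_insert (layer_Iio_le (e := e) hpos α)
        (Z := genericUnit γ (e α) α ν) (orderTop_genericUnit hpos hα ν).ge (by
          rw [genericUnit, coeff_add, hc0, C_apply, coeff_single_zero_mul]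
          exact transcendental_add_mul_gen (by simp [varsBefore])
            (mem_coeffSubfield.1 (trivialization_mem hpos hα ν) 0)
            (orderTop_eq_zero_iff.1 (orderTop_trivialization hpos hα ν)).2 (zero_mem _))
      simpa using this
    · set E := Subfield.closure (layer γ e (Set.Iio α) ∪ genericUnit γ (e α) α '' T) with hE
      have hlE : (layer γ e (Set.Iio α) : Set (Series Γ I W)) ⊆ E := fun x hx =>
        Subfield.subset_closure (Or.inl hx)
      have hντ : ν < τ := hν τ hτ
      have hcoc := ((good_iff α).1 hα)
      have hunit := hcoc.1.unit ν τ hντ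
      have he0 : e α ν τ ≠ 0 := by intro h; rw [h] at hunit; simp at hunit
      set a := (e α ν τ)⁻¹ with ha
      have haE : a ∈ E := inv_mem (hlE (hcoc.2 ν τ))
      have ha0 : a.orderTop = 0 := orderTop_inv_eq_zero hunit
      set c := trivialization γ (e α) α with hc
      set z := genericUnit γ (e α) α with hz
      have hzE : z τ ∈ E := Subfield.subset_closure (Or.inr ⟨τ, hτ, rfl⟩)
      -- The difference `z ν - a * z τ` has order at least `γ ν`. After division by t^(γ ν) its
      -- residue is y_ν plus x times the residue of `h`. The coefficients of `h` involve only
      -- variables already used, and y_ν is new as ν lies below `T`.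
      set Y : Series Γ I W := (z ν - a * z τ) * single (-γ ν) 1 with hY
      set h : Series Γ I W := (c ν - a * c τ) * single (-γ ν) 1 with hh
      have hs : single (γ ν) (1 : CoeffField I W) * single (-γ ν) 1 = 1 :=
        single_one_mul_single_neg _
      have hsgen : ∀ b : CoeffField I W, single (γ ν) b * single (-γ ν) (1 : CoeffField I W)
          = C b := by
        intro b; rw [single_mul_single]; simp [C_apply]
      have hYeq : Y = C (gen (true, α, none)) * h + C (gen (true, α, some ν)) -
          a * (single (γ τ) (gen (true, α, some τ)) * single (-γ ν) 1) := by
        rw [← hsgen (gen (true, α, some ν)), hY, hh, hz]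
        simp only [genericUnit, ← hc]
        ring
      have hhpos : 0 ≤ h.orderTop := by
        have e1 : c ν - a * c τ = a * (c ν * e α ν τ - c τ) := by
          rw [ha]; field_simp
        rw [hh, orderTop_mul, orderTop_single_one, e1, orderTop_mul, ha0, zero_add]
        have := le_orderTop_trivialization hpos hα hντ
        calc (0 : WithTop Γ) = (γ ν : WithTop Γ) + ((-γ ν : Γ) : WithTop Γ) := by
              rw [← WithTop.coe_add]; simp
          _ ≤ _ := by gcongr
      have hlast : 0 < (a * (single (γ τ) (gen (true, α, some τ)) *
          single (-γ ν) (1 : CoeffField I W))).orderTop := by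
        rw [orderTop_mul, ha0, zero_add, single_mul_single, orderTop_single (by simp [gen_ne_zero])]
        have := hmono hντ
        have h2 : 0 < γ τ + -γ ν := by rw [← sub_eq_add_neg]; exact sub_pos.2 this
        exact_mod_cast h2
      have hY0 : 0 ≤ Y.orderTop := by
        rw [hYeq]
        refine le_trans (le_min (le_trans (le_min ?_ ?_) min_orderTop_le_orderTop_add) hlast.le)
          min_orderTop_le_orderTop_sub
        · exact le_orderTop_mul_left (orderTop_single_le (a := (0 : Γ))) hhpos
        · exact orderTop_single_le (a := (0 : Γ))
      have hYres : Y.coeff 0 =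
          gen (true, α, some ν) * 1 + gen (true, α, none) * h.coeff 0 := by
        rw [hYeq, coeff_sub, coeff_eq_zero_of_lt_orderTop hlast, coeff_add, C_apply, C_apply,
          coeff_single_zero_mul, coeff_single_same]
        ring
      have hEle := closure_le_varsUpTo hpos hα (T : Set W)
      have hhmem : h ∈ coeffSubfield Γ (varField (varsUpTo α (T : Set W))) := by
        have hcm : ∀ ν, c ν ∈ coeffSubfield Γ (varField (varsUpTo α (T : Set W))) := fun ν =>
          coeffSubfield_mono (varField_mono (varsBefore_subset_varsUpTo _ _))
            (trivialization_mem hpos hα ν)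
        exact mul_mem (sub_mem (hcm ν) (mul_mem (hEle haE) (hcm τ)))
          (single_mem_coeffSubfield (one_mem _))
      have key : ApproxBy (varField (varsUpTo α (T : Set W))) E
          (Subfield.closure (insert Y (E : Set (Series Γ I W)))) := by
        refine approxBy_closure_insert hEle hY0 ?_
        rw [hYres]
        refine transcendental_add_mul_gen ?_ (one_mem _) one_ne_zero
          (mul_mem (gen_mem_varField (Or.inl (Or.inr rfl))) (mem_coeffSubfield.1 hhmem 0))
        rintro ((h1 | h1) | ⟨μ, hμ, h1⟩)
        · exact lt_irrefl _ (h1 rfl)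
        · simp at h1
        · simp only [Prod.mk.injEq, true_and, Option.some.injEq] at h1
          subst h1
          exact lt_irrefl _ (hν _ hμ)
      have hkey := ih.trans (varField_mono (varsBefore_subset_varsUpTo _ _)) key
      intro f hf
      refine hkey f ?_
      refine (Subfield.closure_le.2 ?_) hf
      apply Set.union_subset
      · exact fun x hx => Subfield.subset_closure (Or.inr (hlE hx))
      · rintro _ ⟨μ, hμ, rfl⟩
        rw [Finset.coe_insert] at hμ
        have hE' : (E : Set (Series Γ I W)) ⊆
          Subfield.closure (insert Y (E : Set (Series Γ I W))) := fun x hx =>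
            Subfield.subset_closure (Or.inr hx)
        rcases hμ with rfl | hμ
        -- Conversely z_ν is recovered from `Y`, so adjoining `Y` to `E` yields a field containing
        -- all generators in question.
        · have e2 : z μ = Y * single (γ μ) 1 + a * z τ := by
            rw [hY, mul_assoc, mul_comm (single (-γ μ) _), hs]; ring
          change z μ ∈ Subfield.closure _
          rw [e2]
          exact add_mem (mul_mem (Subfield.subset_closure (Or.inl rfl))
            (hE' (hlE (single_mem_layer _ _)))) (mul_mem (hE' haE) (hE' hzE))
        · exact hE' (Subfield.subset_closure (Or.inr ⟨μ, hμ, rfl⟩))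

end Stage

/-! ### The whole tower over the base field -/

/-- The base field. -/
noncomputable abbrev baseField (γ : W → Γ) (e : I → W → W → Series Γ I W) : Subfield (Series Γ I W) :=
  layer γ e ∅

/-- The fields generated by the layer before a good stage β and finitely many generators of stage β
form, with the base field, a directed system: for different stages the earlier field lies in the
later one, for equal stages the finite sets are united. -/
theorem exists_stage {A : Set I} {f : Series Γ I W} (hf : f ∈ layer γ e A) :
    f ∈ baseField γ e ∨ ∃ β ∈ A, Good γ e β ∧ ∃ T : Finset W,
      f ∈ Subfield.closure (layer γ e (Set.Iio β) ∪ genericUnit γ (e β) β '' T) := by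
  classical
  let G : I → Finset W → Subfield (Series Γ I W) := fun β T =>
    Subfield.closure (layer γ e (Set.Iio β) ∪ genericUnit γ (e β) β '' T)
  have hlG : ∀ β T, layer γ e (Set.Iio β) ≤ G β T := fun β T x hx =>
    Subfield.subset_closure (Or.inl hx)
  have hGl : ∀ β β' T, Good γ e β → β < β' → G β T ≤ layer γ e (Set.Iio β') := by
    intro β β' T hg h
    rw [Subfield.closure_le]
    apply Set.union_subset
    · exact layer_mono (Set.Iio_subset_Iio h.le)
    · rintro _ ⟨ν, -, rfl⟩
      exact genericUnit_mem_layer (A := Set.Iio β') h hg ν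
  let P : Subfield (Series Γ I W) → Prop := fun D =>
    D = baseField γ e ∨ ∃ β ∈ A, Good γ e β ∧ ∃ T, D = G β T
  have hdir : ∀ D D', P D → P D' → ∃ D'', P D'' ∧ D ≤ D'' ∧ D' ≤ D'' := by
    rintro _ _ (rfl | ⟨β, hβ, hg, T, rfl⟩) (rfl | ⟨β', hβ', hg', T', rfl⟩)
    · exact ⟨_, Or.inl rfl, le_rfl, le_rfl⟩
    · exact ⟨_, Or.inr ⟨β', hβ', hg', T', rfl⟩,
        (layer_mono (Set.empty_subset _)).trans (hlG _ _), le_rfl⟩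
    · exact ⟨_, Or.inr ⟨β, hβ, hg, T, rfl⟩, le_rfl,
        (layer_mono (Set.empty_subset _)).trans (hlG _ _)⟩
    · rcases lt_trichotomy β β' with h | rfl | h
      · exact ⟨_, Or.inr ⟨β', hβ', hg', T', rfl⟩, (hGl _ _ _ hg h).trans (hlG _ _), le_rfl⟩
      · refine ⟨_, Or.inr ⟨β, hβ, hg, T ∪ T', rfl⟩, ?_, ?_⟩ <;>
        · apply Subfield.closure_mono
          apply Set.union_subset_union_right
          apply Set.image_mono
          simp
      · exact ⟨_, Or.inr ⟨β, hβ, hg, T, rfl⟩, le_rfl, (hGl _ _ _ hg' h).trans (hlG _ _)⟩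
  suffices h : ∃ D, P D ∧ f ∈ D by
    obtain ⟨_, rfl | ⟨β, hβ, hg, T, rfl⟩, hD⟩ := h
    · exact Or.inl hD
    · exact Or.inr ⟨β, hβ, hg, T, hD⟩
  induction hf using Subfield.closure_induction with
  | mem x hx =>
    rcases hx with hx | ⟨β, hβ, hg, ν, rfl⟩
    · exact ⟨_, Or.inl rfl, Subfield.subset_closure (Or.inl hx)⟩
    · exact ⟨_, Or.inr ⟨β, hβ, hg, {ν}, rfl⟩, Subfield.subset_closure (Or.inr ⟨ν, by simp, rfl⟩)⟩
  | one => exact ⟨_, Or.inl rfl, one_mem _⟩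
  | add x y _ _ hx hy =>
    obtain ⟨D, hD, hxD⟩ := hx
    obtain ⟨D', hD', hyD⟩ := hy
    obtain ⟨D'', h, h1, h2⟩ := hdir D D' hD hD'
    exact ⟨D'', h, add_mem (h1 hxD) (h2 hyD)⟩
  | neg x _ hx =>
    obtain ⟨D, hD, hxD⟩ := hx
    exact ⟨D, hD, neg_mem hxD⟩
  | inv x _ hx =>
    obtain ⟨D, hD, hxD⟩ := hx
    exact ⟨D, hD, inv_mem hxD⟩
  | mul x y _ _ hx hy =>
    obtain ⟨D, hD, hxD⟩ := hx
    obtain ⟨D', hD', hyD⟩ := hy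
    obtain ⟨D'', h, h1, h2⟩ := hdir D D' hD hD'
    exact ⟨D'', h, mul_mem (h1 hxD) (h2 hyD)⟩

/-- Transfinite induction: an element lies in the base field or in a finite part of some stage β <
α. `approxBy_stage` descends to the layer before β, and the induction hypothesis descends to the
base field. -/
theorem approxBy_layer_Iio (hpos : ∀ μ, 0 < γ μ) (hmono : StrictMono γ) (α : I) :
    ApproxBy (varField (baseVars I W)) (baseField γ e) (layer γ e (Set.Iio α)) := by
  classical
  induction α using WellFoundedLT.induction with
  | ind α ih =>
  intro f hf
  rcases exists_stage hf with h | ⟨β, hβ, hg, T, h⟩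
  · exact fun w _ => ⟨f, h, le_rfl⟩
  · exact ((ih β hβ).trans (varField_mono (baseVars_subset β))
      (approxBy_stage hpos hmono hg T)) f h

/-- Series over the base variables are approximated by elements of the base field as well as by
elements of the whole field. -/
theorem approxBy_layer (hpos : ∀ μ, 0 < γ μ) (hmono : StrictMono γ) (A : Set I) :
    ApproxBy (varField (baseVars I W)) (baseField γ e) (layer γ e A) := by
  classical
  intro f hf
  rcases exists_stage hf with h | ⟨β, hβ, hg, T, h⟩
  · exact fun w _ => ⟨f, h, le_rfl⟩
  · exact ((approxBy_layer_Iio hpos hmono β).trans (varField_mono (baseVars_subset β))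
      (approxBy_stage hpos hmono hg T)) f h

theorem exists_mem_layer_Iio [NoMaxOrder I] [Nonempty I] {f : Series Γ I W}
    (hf : f ∈ layer γ e Set.univ) : ∃ β, f ∈ layer γ e (Set.Iio β) := by
  rcases exists_stage hf with h | ⟨β, -, hg, T, h⟩
  · exact ⟨Classical.arbitrary I, layer_mono (Set.empty_subset _) h⟩
  · obtain ⟨β', hβ'⟩ := exists_gt β
    refine ⟨β', (Subfield.closure_le.2 (Set.union_subset ?_ ?_)) h⟩
    · exact layer_mono (Set.Iio_subset_Iio hβ'.le)
    · rintro _ ⟨ν, -, rfl⟩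
      exact genericUnit_mem_layer (A := Set.Iio β') hβ' hg ν

/-- An element of the base field involves only finitely many variables. -/
theorem exists_finite_vars {f : Series Γ I W} (hf : f ∈ baseField γ e) :
    ∃ T : Set (Var I W), T.Finite ∧ f ∈ coeffSubfield Γ (varField T) := by
  have hm : ∀ {S T : Set (Var I W)} {x : Series Γ I W}, S ⊆ T →
      x ∈ coeffSubfield Γ (varField S) → x ∈ coeffSubfield Γ (varField T) := fun h hx =>
    coeffSubfield_mono (varField_mono h) hx
  induction hf using Subfield.closure_induction with
  | mem x hx =>
    rcases hx with (⟨g, rfl⟩ | ⟨v, hv, rfl⟩) | ⟨β, hβ, -⟩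
    · exact ⟨∅, Set.finite_empty, single_mem_coeffSubfield (one_mem _)⟩
    · exact ⟨{v}, Set.finite_singleton v, single_mem_coeffSubfield (gen_mem_varField rfl)⟩
    · exact hβ.elim
  | one => exact ⟨∅, Set.finite_empty, one_mem _⟩
  | add x y _ _ hx hy =>
    obtain ⟨S, hS, hx⟩ := hx
    obtain ⟨T, hT, hy⟩ := hy
    exact ⟨S ∪ T, hS.union hT, add_mem (hm Set.subset_union_left hx) (hm Set.subset_union_right hy)⟩
  | neg x _ hx =>
    obtain ⟨S, hS, hx⟩ := hx
    exact ⟨S, hS, neg_mem hx⟩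
  | inv x _ hx =>
    obtain ⟨S, hS, hx⟩ := hx
    exact ⟨S, hS, inv_mem hx⟩
  | mul x y _ _ hx hy =>
    obtain ⟨S, hS, hx⟩ := hx
    obtain ⟨T, hT, hy⟩ := hy
    exact ⟨S ∪ T, hS.union hT, mul_mem (hm Set.subset_union_left hx) (hm Set.subset_union_right hy)⟩

end GenericHahn

/-! ### Uniserial modules of type Q/R and cocycles of units -/

section UniserialOfType

variable {R : Type*} [CommRing R] [IsDomain R]

theorem mem_submoduleOf_iff {J A : Submodule R (FractionRing R)} {x : J} :
    x ∈ A.submoduleOf J ↔ (x : FractionRing R) ∈ A := Iff.rfl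

theorem mk_eq_zero_iff_mem_one (x : (⊤ : Submodule R (FractionRing R))) :
    (Submodule.Quotient.mk x : QuotMod R ⊤ 1) = 0 ↔ ∃ y, algebraMap R (FractionRing R) y = x := by
  rw [Submodule.Quotient.mk_eq_zero, mem_submoduleOf_iff, Submodule.mem_one]

theorem algebraMap_fractionRing_ne_zero {r : R} (hr : r ≠ 0) :
    algebraMap R (FractionRing R) r ≠ 0 := by simpa using hr

/-- The class of 1/(rt) works: multiplied by r it becomes 1/t, which is not in R. -/
theorem exists_smul_quotMod_ne_zero {t : R} (ht0 : t ≠ 0) (ht : ¬ IsUnit t) {r : R} (hr : r ≠ 0) :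
    ∃ n : QuotMod R (⊤ : Submodule R (FractionRing R)) 1, r • n ≠ 0 := by
  refine ⟨Submodule.Quotient.mk ⟨(algebraMap R _ (r * t))⁻¹, trivial⟩, ?_⟩
  rw [← Submodule.Quotient.mk_smul, Ne, mk_eq_zero_iff_mem_one]
  rintro ⟨y, hy⟩
  apply ht
  have hr' := algebraMap_fractionRing_ne_zero hr
  have ht' := algebraMap_fractionRing_ne_zero ht0
  rw [Submodule.coe_smul, Algebra.smul_def, map_mul] at hy
  field_simp at hy
  rw [← map_mul, ← map_one (algebraMap R (FractionRing R))] at hy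
  exact IsUnit.of_mul_eq_one_right y (IsFractionRing.injective R (FractionRing R) hy)

theorem exists_smul_quotMod_eq_zero_iff [ValuationRing R]
    (n : QuotMod R (⊤ : Submodule R (FractionRing R)) 1) :
    ∃ s : R, s ≠ 0 ∧ ∀ r : R, r • n = 0 ↔ s ∣ r := by
  obtain ⟨⟨x, hx⟩, rfl⟩ := Submodule.Quotient.mk_surjective _ n
  simp_rw [← Submodule.Quotient.mk_smul, mk_eq_zero_iff_mem_one, Submodule.coe_smul]
  rcases ValuationRing.isInteger_or_isInteger R x with ⟨y, hy⟩ | ⟨s, hs⟩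
  · refine ⟨1, one_ne_zero, fun r => ⟨fun _ => one_dvd r, fun _ => ⟨r * y, ?_⟩⟩⟩
    rw [map_mul, hy, Algebra.smul_def]
  · by_cases hx0 : x = 0
    · subst hx0
      exact ⟨1, one_ne_zero, fun r => ⟨fun _ => one_dvd r, fun _ => ⟨0, by simp⟩⟩⟩
    · have hs0 : s ≠ 0 := by
        rintro rfl
        simp at hs
        exact hx0 hs.symm
      refine ⟨s, hs0, fun r => ⟨?_, ?_⟩⟩
      · rintro ⟨y, hy⟩
        refine ⟨y, IsFractionRing.injective R (FractionRing R) ?_⟩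
        rw [map_mul, hy, hs, Algebra.smul_def]
        field_simp
      · rintro ⟨y, rfl⟩
        refine ⟨y, ?_⟩
        rw [Algebra.smul_def, map_mul, hs]
        field_simp

theorem mem_annIn_algebraMap {U : Type*} [AddCommGroup U] [Module R U] {a : U} {r : R} :
    algebraMap R (FractionRing R) r ∈ annIn R a ↔ r • a = 0 := by
  constructor
  · rintro ⟨r', hr', h⟩
    have := IsFractionRing.injective R (FractionRing R) h
    subst this
    exact hr'
  · intro h
    exact ⟨r, h, rfl⟩

/-- A non-zero element of a module of type `Q/R` has a principal annihilator and is divisible by all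
non-zero ring elements. -/
theorem HasType.exists_divisible [ValuationRing R] {U : Type*} [AddCommGroup U] [Module R U]
    {t : R} (ht0 : t ≠ 0) (ht : ¬ IsUnit t)
    (h : HasType U (⊤ : Submodule R (FractionRing R)) 1) :
    ∃ (a : U) (s : R), s ≠ 0 ∧ (∀ r : R, r • a = 0 ↔ s ∣ r) ∧ a ≠ 0 ∧
      ∀ r : R, r ≠ 0 → ∃ b, r • b = a := by
  obtain ⟨a, ha, ⟨φ⟩⟩ := h
  have hmem : ∀ (r : R) (d : divIn R a),
      r • (Submodule.Quotient.mk d : QuotMod R (divIn R a) (annIn R a)) = 0 ↔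
        r • (d : FractionRing R) ∈ annIn R a := by
    intro r d
    rw [← Submodule.Quotient.mk_smul, Submodule.Quotient.mk_eq_zero, mem_submoduleOf_iff]
    rfl
  have hdiv : ∀ d : FractionRing R, d ∈ divIn R a ↔
      ∃ r : R, (r ≠ 0 ∧ ∃ b : U, r • b = a) ∧ d ∈ invSpan R r := by
    intro d
    change d ∈ ⋃ r ∈ {r : R | r ≠ 0 ∧ ∃ b : U, r • b = a},
      (invSpan R r : Set (FractionRing R)) ↔ _
    simp only [Set.mem_iUnion, exists_prop]
    rfl
  have hone : (1 : FractionRing R) ∈ divIn R a := (hdiv 1).2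
    ⟨1, ⟨one_ne_zero, a, one_smul _ _⟩, Submodule.mem_span_singleton.2 ⟨1, by simp⟩⟩
  obtain ⟨s, hs0, hs⟩ := exists_smul_quotMod_eq_zero_iff (φ (Submodule.Quotient.mk ⟨1, hone⟩))
  have hann : ∀ r : R, r • a = 0 ↔ s ∣ r := by
    intro r
    rw [← hs, ← map_smul, LinearEquiv.map_eq_zero_iff, hmem, ← mem_annIn_algebraMap,
      Algebra.smul_def, mul_one]
  refine ⟨a, s, hs0, hann, ha, fun r hr => ?_⟩
  -- Otherwise every divisor `r₀` of `a` divides `r`, so D(a) ⊆ r⁻¹R and `r * s` annihilates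
  -- D(a)/Ann(a) ≅ Q/R. No non-zero ring element does that.
  by_contra hndvd
  obtain ⟨n, hn⟩ := exists_smul_quotMod_ne_zero ht0 ht (mul_ne_zero hr hs0)
  obtain ⟨m, rfl⟩ := φ.surjective n
  obtain ⟨⟨d, hd⟩, rfl⟩ := Submodule.Quotient.mk_surjective _ m
  apply hn
  rw [← map_smul, LinearEquiv.map_eq_zero_iff, hmem]
  obtain ⟨r₀, ⟨hr₀, b, hb⟩, hd'⟩ := (hdiv d).1 hd
  obtain ⟨x, hx⟩ := Submodule.mem_span_singleton.1 hd'
  rcases ValuationRing.dvd_total r r₀ with ⟨k, rfl⟩ | ⟨k, rfl⟩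
  · exact (hndvd ⟨k • b, by rw [smul_smul, hb]⟩).elim
  · have e : (r₀ * k * s) • d = algebraMap R (FractionRing R) (s * (k * x)) := by
      have := algebraMap_fractionRing_ne_zero hr₀
      rw [← hx, Algebra.smul_def, Algebra.smul_def]
      simp only [map_mul]
      field_simp
    rw [e, mem_annIn_algebraMap, hann]
    exact dvd_mul_right _ _

/-- If s divides r, divide `a` by r/s; if r divides s, multiply `a` by s/r. -/
theorem exists_smul_eq_zero_iff_dvd [ValuationRing R] {U : Type*} [AddCommGroup U] [Module R U]
    {a : U} {s : R} (hs0 : s ≠ 0) (ha : ∀ r : R, r • a = 0 ↔ s ∣ r) (ha0 : a ≠ 0)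
    (hdiv : ∀ r : R, r ≠ 0 → ∃ b, r • b = a) {r : R} (hr : r ≠ 0) :
    ∃ u : U, ∀ x : R, x • u = 0 ↔ r ∣ x := by
  rcases ValuationRing.dvd_total s r with ⟨k, rfl⟩ | ⟨k, rfl⟩
  · have hk : k ≠ 0 := right_ne_zero_of_mul hr
    obtain ⟨u, hu⟩ := hdiv k hk
    refine ⟨u, fun x => ⟨fun hx => ?_, ?_⟩⟩
    · rcases ValuationRing.dvd_total k x with ⟨y, rfl⟩ | ⟨y, rfl⟩
      · rw [mul_comm, mul_smul, hu, ha] at hx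
        rw [mul_comm s]
        exact mul_dvd_mul_left k hx
      · rw [mul_comm, mul_smul, hx, smul_zero] at hu
        exact (ha0 hu.symm).elim
    · rintro ⟨y, rfl⟩
      have e : s * k * y = y * s * k := by ring
      rw [e, mul_smul, hu, mul_smul, (ha s).2 dvd_rfl, smul_zero]
  · have hk : k ≠ 0 := right_ne_zero_of_mul hs0
    refine ⟨k • a, fun x => ?_⟩
    rw [smul_smul, ha]
    exact mul_dvd_mul_iff_right hk

theorem isUnit_of_smul_eq [ValuationRing R] {U : Type*} [AddCommGroup U] [Module R U]
    {u v : U} {r ρ : R} (hr : r ≠ 0) (hru : ¬ IsUnit r) (hu : ∀ x : R, x • u = 0 ↔ r ∣ x)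
    (hv : ∀ x : R, x • v = 0 ↔ r ∣ x) (h : ρ • u = v) : IsUnit ρ := by
  rcases ValuationRing.dvd_total ρ r with ⟨k, hk⟩ | hk
  · have : r ∣ k := by
      rw [← hv, ← h, smul_smul, hu, mul_comm, hk]
    obtain ⟨l, rfl⟩ := this
    have : r * (ρ * l) = r * 1 := by rw [mul_one]; nth_rewrite 2 [hk]; ring
    exact IsUnit.of_mul_eq_one l (mul_left_cancel₀ hr this)
  · have h0 : v = 0 := by rw [← h, hu]; exact hk
    have := (hv 1).1 (by rw [h0, smul_zero])
    exact (hru (isUnit_of_dvd_one this)).elim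

theorem IsUniserial.exists_isUnit_smul_eq [ValuationRing R] {U : Type*} [AddCommGroup U]
    [Module R U] (hU : IsUniserial R U) {u v : U} {r : R} (hr : r ≠ 0) (hru : ¬ IsUnit r)
    (hu : ∀ x : R, x • u = 0 ↔ r ∣ x) (hv : ∀ x : R, x • v = 0 ↔ r ∣ x) :
    ∃ ρ : R, IsUnit ρ ∧ v = ρ • u := by
  rcases hU (R ∙ u) (R ∙ v) with h | h
  · obtain ⟨ρ, hρ⟩ := Submodule.mem_span_singleton.1 (h (Submodule.mem_span_singleton_self u))
    obtain ⟨w, rfl⟩ := isUnit_of_smul_eq hr hru hv hu hρ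
    exact ⟨_, (w⁻¹).isUnit, by rw [← hρ, smul_smul, Units.inv_mul, one_smul]⟩
  · obtain ⟨ρ, hρ⟩ := Submodule.mem_span_singleton.1 (h (Submodule.mem_span_singleton_self v))
    exact ⟨ρ, isUnit_of_smul_eq hr hru hu hv hρ, hρ.symm⟩

variable {W : Type*} [LinearOrder W]

/-- A module that is the union of a chain of cyclic modules `R/(r ν)` with the standard transition
maps is `Q/R`. -/
theorem nonempty_linearEquiv_quotMod [ValuationRing R] [Nonempty W] {U : Type*} [AddCommGroup U]
    [Module R U] {r : W → R} (hr0 : ∀ ν, r ν ≠ 0) (hcof : ∀ x : R, x ≠ 0 → ∃ ν, ¬ r ν ∣ x)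
    (q : W → W → R) (hq : ∀ μ ν, μ < ν → r ν = r μ * q μ ν)
    (u : W → U) (hu : ∀ ν, ∀ x : R, x • u ν = 0 ↔ r ν ∣ x) (hcov : ∀ y, ∃ ν, ∃ x : R, y = x • u ν)
    (htrans : ∀ μ ν, μ < ν → q μ ν • u ν = u μ) :
    Nonempty (U ≃ₗ[R] QuotMod R (⊤ : Submodule R (FractionRing R)) 1) := by
  set ι := algebraMap R (FractionRing R) with hι
  have hr0' : ∀ ν, ι (r ν) ≠ 0 := fun ν => algebraMap_fractionRing_ne_zero (hr0 ν)
  have hmono : ∀ (z : FractionRing R) (ν x τ), z * ι (r ν) = ι x → ν ≤ τ →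
      ∃ x', z * ι (r τ) = ι x' ∧ x' • u τ = x • u ν := by
    intro z ν x τ hz h
    rcases h.eq_or_lt with rfl | h
    · exact ⟨x, hz, rfl⟩
    · refine ⟨x * q ν τ, ?_, ?_⟩
      · rw [hq ν τ h, map_mul, map_mul, ← mul_assoc, hz]
      · rw [mul_smul, htrans ν τ h]
  have hex : ∀ z : FractionRing R, ∃ p : W × R, z * ι (r p.1) = ι p.2 := by
    intro z
    obtain ⟨a, b, hb, rfl⟩ := IsFractionRing.div_surjective (A := R) z
    have hb0 : b ≠ 0 := nonZeroDivisors.ne_zero hb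
    obtain ⟨ν, hν⟩ := hcof b hb0
    obtain ⟨k, hk⟩ := (ValuationRing.dvd_total (r ν) b).resolve_left hν
    refine ⟨(ν, a * k), ?_⟩
    have := algebraMap_fractionRing_ne_zero hb0
    change ι b ≠ 0 at this
    simp only [hk, map_mul, ← hι]
    field_simp
  -- The map sends z = x / r_ν to x • u ν. `p` chooses such a representation, and `hwd` shows that
  -- the choice does not matter.
  choose p hp using hex
  have hwd : ∀ (z : FractionRing R) (ν ν' x x'), z * ι (r ν) = ι x → z * ι (r ν') = ι x' →
      x • u ν = x' • u ν' := by
    have aux : ∀ (z : FractionRing R) (ν ν' x x'), ν ≤ ν' → z * ι (r ν) = ι x →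
        z * ι (r ν') = ι x' → x • u ν = x' • u ν' := by
      intro z ν ν' x x' hle h h'
      obtain ⟨x'', h1, h2⟩ := hmono z ν x ν' h hle
      have : x'' = x' := IsFractionRing.injective R (FractionRing R) (h1.symm.trans h')
      rw [← h2, this]
    intro z ν ν' x x' h h'
    rcases le_total ν ν' with hle | hle
    · exact aux z ν ν' x x' hle h h'
    · exact (aux z ν' ν x' x hle h' h).symm
  have hf : ∀ z ν x, z * ι (r ν) = ι x → (p z).2 • u (p z).1 = x • u ν := fun z ν x h =>
    hwd z _ _ _ _ (hp z) h
  let f : FractionRing R →ₗ[R] U :=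
    { toFun := fun z => (p z).2 • u (p z).1
      map_add' := by
        intro z z'
        obtain ⟨y, hy, hy'⟩ := hmono z _ _ (max (p z).1 (p z').1) (hp z) (le_max_left _ _)
        obtain ⟨y', hy1, hy1'⟩ := hmono z' _ _ (max (p z).1 (p z').1) (hp z') (le_max_right _ _)
        rw [← hy', ← hy1', ← add_smul]
        apply hf
        rw [add_mul, hy, hy1, map_add]
      map_smul' := by
        intro c z
        rw [RingHom.id_apply, smul_smul]
        apply hf
        rw [Algebra.smul_def, mul_assoc, hp, map_mul] }
  have hf' : ∀ z ν x, z * ι (r ν) = ι x → f z = x • u ν := hf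
  let g : (⊤ : Submodule R (FractionRing R)) →ₗ[R] U := f ∘ₗ Submodule.subtype ⊤
  have hg : Function.Surjective g := by
    intro y
    obtain ⟨ν, x, rfl⟩ := hcov y
    refine ⟨⟨ι x / ι (r ν), Submodule.mem_top⟩, hf' _ _ _ ?_⟩
    exact div_mul_cancel₀ _ (hr0' ν)
  have hker : (1 : Submodule R (FractionRing R)).submoduleOf ⊤ = LinearMap.ker g := by
    ext ⟨z, hz⟩
    rw [mem_submoduleOf_iff, Submodule.mem_one, LinearMap.mem_ker]
    change _ ↔ (p z).2 • u (p z).1 = 0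
    rw [hu]
    have h1 := hp z
    have h2 := hr0' (p z).1
    constructor
    · rintro ⟨y, hy⟩
      refine ⟨y, IsFractionRing.injective R (FractionRing R) ?_⟩
      change ι _ = ι _
      have hy' : ι y = z := hy
      rw [map_mul, hy', ← h1]; ring
    · rintro ⟨y, hy⟩
      refine ⟨y, mul_right_cancel₀ h2 ?_⟩
      change ι y * _ = z * _
      rw [h1, hy, map_mul]; ring
  exact ⟨((Submodule.quotEquivOfEq _ _ hker).trans (g.quotKerEquivOfSurjective hg)).symm⟩

/-- If multiplicative cocycles along a chain of principal ideals with zero intersection are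
coboundaries, then uniserial modules of type `Q/R` are standard. -/
theorem isStandard_of_cocycles_trivial [ValuationRing R] [Nonempty W] {r : W → R}
    (hr0 : ∀ ν, r ν ≠ 0) (hru : ∀ ν, ¬ IsUnit (r ν)) (hdvd : ∀ μ ν, μ < ν → r μ ∣ r ν)
    (hcof : ∀ x : R, x ≠ 0 → ∃ ν, ¬ r ν ∣ x)
    (htriv : ∀ e : W → W → R, (∀ μ ν, IsUnit (e μ ν)) →
      (∀ μ ν τ, μ < ν → ν < τ → r μ ∣ e μ ν * e ν τ - e μ τ) →
      ∃ c : W → R, (∀ ν, IsUnit (c ν)) ∧ ∀ μ ν, μ < ν → r μ ∣ c μ * e μ ν - c ν)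
    {U : Type*} [AddCommGroup U] [Module R U] (hU : IsUniserial R U)
    (hT : HasType U (⊤ : Submodule R (FractionRing R)) 1) : IsStandard R U := by
  have ν₀ := Classical.arbitrary W
  obtain ⟨a, s, hs0, ha, ha0, hdiv⟩ := hT.exists_divisible (hr0 ν₀) (hru ν₀)
  choose u hu using fun ν => exists_smul_eq_zero_iff_dvd hs0 ha ha0 hdiv (hr0 ν)
  have hq : ∀ μ ν, ∃ q, μ < ν → r ν = r μ * q := by
    intro μ ν
    by_cases h : μ < ν
    · obtain ⟨q, hq⟩ := hdvd μ ν h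
      exact ⟨q, fun _ => hq⟩
    · exact ⟨0, fun h' => (h h').elim⟩
  choose q hq using hq
  have hq0 : ∀ μ ν, μ < ν → q μ ν ≠ 0 := fun μ ν h h0 => by
    have := hq μ ν h
    rw [h0, mul_zero] at this
    exact hr0 ν this
  -- `q μ ν • u ν` and `u μ` both have annihilator r_μ R, so in a uniserial module they differ by a
  -- unit. Values for μ ≥ ν are fillers.
  have he : ∀ μ ν, ∃ e : R, IsUnit e ∧ (μ < ν → q μ ν • u ν = e • u μ) := by
    intro μ ν
    by_cases h : μ < ν
    · obtain ⟨e, he, h'⟩ := hU.exists_isUnit_smul_eq (hr0 μ) (hru μ) (hu μ) (v := q μ ν • u ν)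
        (fun x => by
          rw [smul_smul, hu, hq μ ν h]
          exact mul_dvd_mul_iff_right (hq0 μ ν h))
      exact ⟨e, he, fun _ => h'⟩
    · exact ⟨1, isUnit_one, fun h' => (h h').elim⟩
  choose e heu he using he
  obtain ⟨c, hcu, hc⟩ := htriv e heu (by
    intro μ ν τ h h'
    rw [← hu, sub_smul, sub_eq_zero, mul_comm, mul_smul, ← he μ ν h, smul_comm, ← he ν τ h',
      ← he μ τ (h.trans h'), smul_smul]
    congr 1
    apply mul_left_cancel₀ (hr0 μ)
    rw [← mul_assoc, ← hq μ ν h, ← hq ν τ h', hq μ τ (h.trans h')])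
  choose w hw using hcu
  -- Comparison with `a` gives a non-zero `k` killing `y`. If r_ν does not divide `k`, then `k` does
  -- not kill `u ν`, so `u ν` is not a multiple of `y`.
  have hcov : ∀ y, ∃ ν, ∃ x : R, y = x • u ν := by
    intro y
    by_contra! hy
    obtain ⟨k, hk0, hk⟩ : ∃ k : R, k ≠ 0 ∧ k • y = 0 := by
      rcases hU (R ∙ y) (R ∙ a) with h | h
      · obtain ⟨ρ, hρ⟩ := Submodule.mem_span_singleton.1 (h (Submodule.mem_span_singleton_self y))
        exact ⟨s, hs0, by rw [← hρ, smul_comm, (ha s).2 dvd_rfl, smul_zero]⟩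
      · obtain ⟨ρ, hρ⟩ := Submodule.mem_span_singleton.1 (h (Submodule.mem_span_singleton_self a))
        refine ⟨s * ρ, mul_ne_zero hs0 ?_, by rw [mul_smul, hρ, (ha s).2 dvd_rfl]⟩
        rintro rfl
        exact ha0 (by rw [← hρ, zero_smul])
    obtain ⟨ν, hν⟩ := hcof k hk0
    rcases hU (R ∙ y) (R ∙ u ν) with h | h
    · obtain ⟨ρ, hρ⟩ := Submodule.mem_span_singleton.1 (h (Submodule.mem_span_singleton_self y))
      exact hy ν ρ hρ.symm
    · obtain ⟨ρ, hρ⟩ := Submodule.mem_span_singleton.1 (h (Submodule.mem_span_singleton_self (u ν)))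
      apply hν
      rw [← hu, ← hρ, smul_comm, hk, smul_zero]
  -- Rescaling `u ν` by the inverse of `c ν` turns the transition maps into the standard ones.
  refine ⟨⊤, 1, le_top, nonempty_linearEquiv_quotMod hr0 hcof q hq
    (fun ν => ((w ν)⁻¹ : Rˣ) • u ν) ?_ ?_ ?_⟩
  · intro ν x
    rw [smul_comm, smul_eq_zero_iff_eq, hu]
  · intro y
    obtain ⟨ν, x, rfl⟩ := hcov y
    refine ⟨ν, x * w ν, ?_⟩
    rw [mul_smul, Units.smul_def, smul_smul (w ν : R), Units.mul_inv, one_smul]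
  · intro μ ν h
    rw [smul_comm, he μ ν h, Units.smul_def, Units.smul_def, smul_smul, ← sub_eq_zero, ← sub_smul,
      hu]
    have h1 := hc μ ν h
    rw [← hw, ← hw] at h1
    have e1 : ((w ν)⁻¹ : Rˣ) * e μ ν - ((w μ)⁻¹ : Rˣ) =
        (w μ * e μ ν - w ν) * (((w μ)⁻¹ : Rˣ) * ((w ν)⁻¹ : Rˣ)) := by
      have h2 := (w μ).mul_inv
      have h3 := (w ν).mul_inv
      linear_combination (-(e μ ν * ((w ν)⁻¹ : Rˣ))) * h2 + (((w μ)⁻¹ : Rˣ) : R) * h3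
    rw [e1]
    exact h1.mul_right _

end UniserialOfType

/-! ### Clubs and ladders in ω₁ -/

section Clubs

open Order Set Cardinal

theorem Omega1.countable_Iio (δ : Omega1) : (Iio δ).Countable := by
  have h1 : (Iio (δ : Ordinal.{0})).Countable := by
    rw [← le_aleph0_iff_set_countable, mk_Iio_ordinal, lift_le_aleph0]
    obtain ⟨d, h⟩ := δ
    rw [mem_Iio, ← ord_aleph, lt_ord, ← succ_aleph0, lt_succ_iff] at h
    exact h
  exact (h1.preimage (f := ((↑) : Omega1 → Ordinal.{0})) Subtype.val_injective).mono fun _ h => h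

theorem Omega1.exists_gt_of_countable {s : Set Omega1} (hs : s.Countable) : ∃ b, ∀ x ∈ s, x < b := by
  have h : ¬ IsCofinal s := by
    intro h
    have h1 := (cof_le h).trans (le_aleph0_iff_set_countable.2 hs)
    rw [Ordinal.cof_Iio, Ordinal.lift_omega] at h1
    simp at h1
  simpa [IsCofinal] using h

/-- The limit points closed under a function form a club. -/
theorem Omega1.isClub_closedUnder (f : Omega1 → Omega1) :
    IsClub {δ | IsSuccLimit δ ∧ ∀ ν < δ, f ν < δ} := by
  constructor
  · intro t ht htne _ a ha
    by_cases hat : a ∈ t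
    · exact ht hat
    have hlt : ∀ x ∈ t, x < a := fun x hx =>
      lt_of_le_of_ne (ha.1 hx) fun h => hat (h ▸ hx)
    have hex : ∀ ν < a, ∃ x ∈ t, ν < x := by
      intro ν hν
      by_contra! h
      exact (ha.2 h).not_gt hν
    refine ⟨⟨?_, ?_⟩, ?_⟩
    · obtain ⟨x, hx⟩ := htne
      exact fun h => (hlt x hx).not_ge (h (hlt x hx).le)
    · intro b hb
      obtain ⟨x, hx, hbx⟩ := hex b hb.1
      exact hb.2 hbx (hlt x hx)
    · intro ν hν
      obtain ⟨x, hx, hνx⟩ := hex ν hν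
      exact ((ht hx).2 ν hνx).trans (hlt x hx)
  · intro a
    have hb : ∀ ν : Omega1, ∃ b, ν < b ∧ ∀ μ < ν, f μ < b := by
      intro ν
      obtain ⟨b, hb⟩ := Omega1.exists_gt_of_countable
        (s := insert ν (f '' Iio ν)) (((Omega1.countable_Iio ν).image f).insert ν)
      exact ⟨b, hb ν (mem_insert _ _), fun μ hμ => hb _ (mem_insert_of_mem _ ⟨μ, hμ, rfl⟩)⟩
    choose b hb1 hb2 using hb
    -- The least strict upper bound of the iterates of `b` is a limit closed under `f`.
    let g : ℕ → Omega1 := fun n => b^[n] a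
    have hg : ∀ n, g (n + 1) = b (g n) := fun n => Function.iterate_succ_apply' b n a
    obtain ⟨c, hc⟩ := Omega1.exists_gt_of_countable (countable_range g)
    obtain ⟨δ, hδ, hmin⟩ := (wellFounded_lt (α := Omega1)).has_min {c | ∀ n, g n < c}
      ⟨c, fun n => hc _ ⟨n, rfl⟩⟩
    have hex : ∀ ν < δ, ∃ n, ν < g n := by
      intro ν hν
      by_contra! h
      exact hmin ν (fun n => by
        refine lt_of_lt_of_le ?_ (h (n + 1))
        rw [hg]; exact hb1 _) hν
    refine ⟨δ, ⟨⟨?_, ?_⟩, ?_⟩, (hδ 0).le⟩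
    · exact fun h => (hδ 0).not_ge (h (hδ 0).le)
    · intro x hx
      obtain ⟨n, hn⟩ := hex x hx.1
      exact hx.2 hn (hδ n)
    · intro ν hν
      obtain ⟨n, hn⟩ := hex ν hν
      refine lt_trans (hb2 _ _ hn) ?_
      rw [← hg]
      exact hδ _

/-- A limit ordinal below `ω₁` has a cofinal subset with finite proper initial segments. -/
theorem Omega1.exists_ladder {δ : Omega1} (hδ : IsSuccLimit δ) :
    ∃ D : Set Omega1, D ⊆ Iio δ ∧ (∀ ν < δ, (D ∩ Iio ν).Finite) ∧ ∀ ν < δ, ∃ μ ∈ D, ν ≤ μ := by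
  have hc : Countable (Iio δ) := (Omega1.countable_Iio δ).to_subtype
  have hne : Nonempty (Iio δ) := by
    obtain ⟨x, hx⟩ := not_isMin_iff.1 hδ.1
    exact ⟨⟨x, hx⟩⟩
  obtain ⟨x, hx, hxt⟩ := Filter.exists_seq_monotone_tendsto_atTop_atTop (Iio δ)
  refine ⟨range fun n => (x n : Omega1), ?_, ?_, ?_⟩
  · rintro _ ⟨n, rfl⟩
    exact (x n).2
  · intro ν hν
    obtain ⟨N, hN⟩ := (hxt.eventually_ge_atTop ⟨ν, hν⟩).exists_forall_of_atTop
    refine ((finite_Iio N).image fun n => (x n : Omega1)).subset ?_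
    rintro _ ⟨⟨n, rfl⟩, hn⟩
    refine ⟨n, ?_, rfl⟩
    by_contra h
    exact (hN n (not_lt.1 h)).not_gt hn
  · intro ν hν
    obtain ⟨N, hN⟩ := (hxt.eventually_ge_atTop ⟨ν, hν⟩).exists
    exact ⟨_, ⟨N, rfl⟩, hN⟩

end Clubs

/-! ### The invariant Γ for the type Q/R -/

section Gamma

variable {R : Type*} [CommRing R] [IsDomain R]

theorem inv_mem_invSpan_iff {x r : R} (hx : x ≠ 0) (hr : r ≠ 0) :
    (algebraMap R (FractionRing R) x)⁻¹ ∈ invSpan R r ↔ x ∣ r := by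
  have hx' := algebraMap_fractionRing_ne_zero hx
  have hr' := algebraMap_fractionRing_ne_zero hr
  rw [invSpan, Submodule.mem_span_singleton]
  constructor
  · rintro ⟨y, hy⟩
    refine ⟨y, IsFractionRing.injective R (FractionRing R) ?_⟩
    rw [Algebra.smul_def] at hy
    rw [map_mul]
    field_simp at hy
    exact hy.symm.trans (mul_comm _ _)
  · rintro ⟨y, rfl⟩
    refine ⟨y, ?_⟩
    rw [map_mul] at hr'
    have hy' := right_ne_zero_of_mul hr'
    rw [Algebra.smul_def, map_mul]
    field_simp

theorem isGenSeq_top_iff {r : Omega1 → R} :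
    IsGenSeq r (⊤ : Submodule R (FractionRing R)) ↔ (∀ ν, r ν ≠ 0) ∧
      (∀ μ ν, μ < ν → r μ ∣ r ν) ∧ ∀ x : R, x ≠ 0 → ∃ ν, x ∣ r ν := by
  constructor
  · intro h
    refine ⟨h.ne_zero, h.dvd, fun x hx => ?_⟩
    have : (algebraMap R (FractionRing R) x)⁻¹ ∈ ((⊤ : Submodule R (FractionRing R)) : Set _) :=
      Submodule.mem_top
    rw [h.union, Set.mem_iUnion] at this
    obtain ⟨ν, hν⟩ := this
    exact ⟨ν, (inv_mem_invSpan_iff hx (h.ne_zero ν)).1 hν⟩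
  · rintro ⟨h0, h1, h2⟩
    refine ⟨h0, h1, Set.eq_of_subset_of_subset ?_ fun x _ => Submodule.mem_top⟩
    intro z _
    obtain ⟨a, b, hb, rfl⟩ := IsFractionRing.div_surjective (A := R) z
    have hb0 : b ≠ 0 := nonZeroDivisors.ne_zero hb
    obtain ⟨ν, hν⟩ := h2 b hb0
    rw [Set.mem_iUnion]
    refine ⟨ν, ?_⟩
    rw [div_eq_mul_inv, ← Algebra.smul_def]
    exact Submodule.smul_mem _ _ ((inv_mem_invSpan_iff hb0 (h0 ν)).2 hν)

/-- With A = R the ideal (A : J_δ) is the intersection of the r_νR, ν < δ, so completeness concerns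
limits of compatible residues modulo these ideals. -/
theorem mem_colon_partialUnion {r : Omega1 → R} (hr : ∀ ν, r ν ≠ 0) {δ : Omega1} {x : R} :
    x ∈ (1 : Submodule R (FractionRing R)).colon (partialUnion r δ) ↔ ∀ ν < δ, r ν ∣ x := by
  rw [Submodule.mem_colon]
  have key : ∀ ν, x • (algebraMap R (FractionRing R) (r ν))⁻¹ ∈
      (1 : Submodule R (FractionRing R)) ↔ r ν ∣ x := by
    intro ν
    have hr' := algebraMap_fractionRing_ne_zero (hr ν)
    rw [Submodule.mem_one]
    constructor
    · rintro ⟨y, hy⟩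
      refine ⟨y, IsFractionRing.injective R (FractionRing R) ?_⟩
      rw [Algebra.smul_def] at hy
      rw [map_mul, hy]
      field_simp
    · rintro ⟨y, rfl⟩
      refine ⟨y, ?_⟩
      rw [Algebra.smul_def, map_mul]
      field_simp
  constructor
  · intro h ν hν
    refine (key ν).1 (h _ ?_)
    simp only [partialUnion, Set.mem_iUnion]
    exact ⟨ν, hν, Submodule.mem_span_singleton_self _⟩
  · intro h s hs
    simp only [partialUnion, Set.mem_iUnion] at hs
    obtain ⟨ν, hν, hs⟩ := hs
    obtain ⟨y, rfl⟩ := Submodule.mem_span_singleton.1 hs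
    rw [smul_comm]
    exact Submodule.smul_mem _ _ ((key ν).2 (h ν hν))

theorem mk_mem_nbhdSubmodule {r : Omega1 → R} (hr : ∀ ν, r ν ≠ 0) {δ : Omega1} {ν : Set.Iio δ}
    {x : R} : (Submodule.Quotient.mk x : R ⧸ (1 : Submodule R (FractionRing R)).colon
      (partialUnion r δ)) ∈ nbhdSubmodule r 1 δ ν ↔ r ν ∣ x := by
  have key : ∀ z : R, algebraMap R (FractionRing R) z ∈
      r ν • (1 : Submodule R (FractionRing R)) ↔ r ν ∣ z := by
    intro z
    rw [Submodule.mem_smul_pointwise_iff_exists]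
    constructor
    · rintro ⟨y, hy, h⟩
      obtain ⟨y, rfl⟩ := Submodule.mem_one.1 hy
      rw [Algebra.smul_def, ← map_mul] at h
      exact ⟨y, (IsFractionRing.injective R (FractionRing R) h).symm⟩
    · rintro ⟨y, rfl⟩
      exact ⟨_, Submodule.mem_one.2 ⟨y, rfl⟩, by rw [Algebra.smul_def, map_mul]⟩
  rw [nbhdSubmodule, Submodule.mem_map]
  constructor
  · rintro ⟨z, hz, h⟩
    have h1 := (key z).1 hz
    have h2 := (Submodule.Quotient.eq _).1 h
    have h3 := (mem_colon_partialUnion hr).1 h2 ν ν.2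
    exact (dvd_sub_right h1).1 h3
  · intro h
    exact ⟨x, (key x).2 h, rfl⟩

/-- In a complete quotient, compatible systems of residues have a common lift. -/
theorem exists_lift_of_completeSpace {r : Omega1 → R} (hr : ∀ ν, r ν ≠ 0)
    (hdvd : ∀ μ ν, μ < ν → r μ ∣ r ν) {δ : Omega1} (hδ : Order.IsSuccLimit δ)
    (hcomp : @CompleteSpace (R ⧸ (1 : Submodule R (FractionRing R)).colon (partialUnion r δ))
      (linearUniformSpace (nbhdSubmodule r 1 δ)))
    (a : Omega1 → R) (ha : ∀ μ ν, μ ≤ ν → ν < δ → r μ ∣ a μ - a ν) :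
    ∃ f : R, ∀ ν < δ, r ν ∣ f - a ν := by
  let _ := linearUniformSpace (nbhdSubmodule r 1 δ)
  have hne : Nonempty (Set.Iio δ) := by
    obtain ⟨x, hx⟩ := not_isMin_iff.1 hδ.1
    exact ⟨⟨x, hx⟩⟩
  have hdir : Directed (· ≥ ·) (nbhdSubmodule r (1 : Submodule R (FractionRing R)) δ) := by
    refine directed_of_isDirected_le fun i j hij x hx => ?_
    obtain ⟨x, rfl⟩ := Submodule.Quotient.mk_surjective _ x
    rw [mk_mem_nbhdSubmodule hr] at hx ⊢
    rcases hij.eq_or_lt with rfl | h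
    · exact hx
    · exact (hdvd _ _ h).trans hx
  have hbasis := linearUniformSpace_hasBasis _ hdir
  let g : Set.Iio δ → R ⧸ (1 : Submodule R (FractionRing R)).colon (partialUnion r δ) :=
    fun ν => Submodule.Quotient.mk (a ν)
  have hcauchy : Cauchy (Filter.map g Filter.atTop) := by
    rw [hbasis.cauchy_iff]
    refine ⟨inferInstance, fun i _ => ?_⟩
    refine ⟨g '' Set.Ici i, Filter.image_mem_map (Filter.mem_atTop i), ?_⟩
    rintro _ ⟨μ, hμ, rfl⟩ _ ⟨ν, hν, rfl⟩
    change Submodule.Quotient.mk (a μ) - Submodule.Quotient.mk (a ν) ∈ nbhdSubmodule r 1 δ i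
    rw [← Submodule.Quotient.mk_sub, mk_mem_nbhdSubmodule hr]
    have h1 := ha i μ hμ μ.2
    have h2 := ha i ν hν ν.2
    have := dvd_sub h2 h1
    rwa [sub_sub_sub_cancel_left] at this
  obtain ⟨y, hy⟩ := hcomp.complete hcauchy
  obtain ⟨f, rfl⟩ := Submodule.Quotient.mk_surjective _ y
  refine ⟨f, fun ν hν => ?_⟩
  have h1 := (nhds_basis_uniformity' hbasis (x := Submodule.Quotient.mk f)).mem_of_mem
    (i := ⟨ν, hν⟩) trivial
  have h2 := hy h1
  obtain ⟨μ, hμ, hmem⟩ :=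
    ((Filter.eventually_ge_atTop (⟨ν, hν⟩ : Set.Iio δ)).and (Filter.mem_map.1 h2)).exists
  have h3 : (Submodule.Quotient.mk f : R ⧸ (1 : Submodule R (FractionRing R)).colon
      (partialUnion r δ)) - Submodule.Quotient.mk (a μ) ∈ nbhdSubmodule r 1 δ ⟨ν, hν⟩ := hmem
  rw [← Submodule.Quotient.mk_sub, mk_mem_nbhdSubmodule hr] at h3
  have h4 := dvd_sub h3 (ha ν μ hμ μ.2)
  have e : f - a ν = (f - a μ) - (a ν - a μ) := by ring
  rwa [e]

/-- If no element of `R` realizes the limit of suitable compatible systems of residues modulo the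
`ρ ν` for `ν < δ`, then `Γ_R(Q/R) = 1`. -/
theorem gammaEq_one_of_unrealized {ρ : Omega1 → R} (hρ0 : ∀ ν, ρ ν ≠ 0)
    (hρ : ∀ μ ν, μ < ν → ρ μ ∣ ρ ν) (hcof : ∀ x : R, x ≠ 0 → ∃ ν, x ∣ ρ ν)
    (hun : ∀ δ : Omega1, Order.IsSuccLimit δ → ∃ a : Omega1 → R,
      (∀ μ ν, μ ≤ ν → ν < δ → ρ μ ∣ a μ - a ν) ∧ ¬ ∃ f : R, ∀ ν < δ, ρ ν ∣ f - a ν) :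
    GammaEq (⊤ : Submodule R (FractionRing R)) 1 1 := by
  refine ⟨⟨ρ, isGenSeq_top_iff.2 ⟨hρ0, hρ, hcof⟩⟩, fun r hr => ?_⟩
  obtain ⟨hr0, hr, hrcof⟩ := isGenSeq_top_iff.1 hr
  rw [ClubClass.mk_eq_one_iff]
  choose p hp using fun ν => hcof (r ν) (hr0 ν)
  choose q hq using fun ν => hrcof (ρ ν) (hρ0 ν)
  -- If δ is closed under `p` and `q`, then `r` and `ρ` restricted to δ are cofinal in each other
  -- for divisibility, so a lift of the reindexed system along `r` would realize the given system
  -- along `ρ`.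
  refine ⟨_, Omega1.isClub_closedUnder fun ν => max (p ν) (q ν), ?_⟩
  rintro δ ⟨hδ, hcl⟩
  refine ⟨hδ, fun hcomp => ?_⟩
  obtain ⟨a, ha, hna⟩ := hun δ hδ
  have hpδ : ∀ ν < δ, p ν < δ := fun ν hν => (le_max_left _ _).trans_lt (hcl ν hν)
  have hqδ : ∀ ν < δ, q ν < δ := fun ν hν => (le_max_right _ _).trans_lt (hcl ν hν)
  obtain ⟨f, hf⟩ := exists_lift_of_completeSpace hr0 hr hδ hcomp (fun ν => a (p ν)) (by
    intro μ ν hμν hν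
    rcases le_total (p μ) (p ν) with h | h
    · exact (hp μ).trans (ha _ _ h (hpδ ν hν))
    · have h1 := ha _ _ h (hpδ μ (hμν.trans_lt hν))
      rw [← dvd_neg, neg_sub] at h1
      have h2 : r μ ∣ r ν := by
        rcases hμν.eq_or_lt with rfl | h'
        · exact dvd_rfl
        · exact hr _ _ h'
      exact (h2.trans (hp ν)).trans h1)
  refine hna ⟨f, fun ν hν => ?_⟩
  have h1 := (hq ν).trans (hf (q ν) (hqδ ν hν))
  have h2 : ρ ν ∣ a (p (q ν)) - a ν := by
    rcases le_total ν (p (q ν)) with h | h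
    · rw [← dvd_neg, neg_sub]
      exact ha _ _ h (hpδ _ (hqδ ν hν))
    · exact ((hq ν).trans (hp _)).trans (ha _ _ h hν)
  have := dvd_add h1 h2
  rwa [sub_add_sub_cancel] at this

end Gamma

/-! ### The valuation ring of a field of Hahn series -/

namespace HahnSeries

variable {Γ K : Type*} [AddCommGroup Γ] [LinearOrder Γ] [IsOrderedAddMonoid Γ] [Field K]

/-- The elements of non-negative order in a field of Hahn series. -/
def integerSubring (F : Subfield (HahnSeries Γ K)) : Subring (HahnSeries Γ K) where
  carrier := {f | f ∈ F ∧ 0 ≤ f.orderTop}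
  mul_mem' := fun ha hb => ⟨mul_mem ha.1 hb.1, le_orderTop_mul_left ha.2 hb.2⟩
  one_mem' := ⟨one_mem _, orderTop_one.ge⟩
  add_mem' := fun ha hb =>
    ⟨add_mem ha.1 hb.1, (le_min ha.2 hb.2).trans min_orderTop_le_orderTop_add⟩
  zero_mem' := ⟨zero_mem _, by simp⟩
  neg_mem' := fun ha => ⟨neg_mem ha.1, by rw [orderTop_neg]; exact ha.2⟩

variable {F : Subfield (HahnSeries Γ K)}

theorem dvd_iff_orderTop_le {a b : integerSubring F} :
    a ∣ b ↔ (a : HahnSeries Γ K).orderTop ≤ (b : HahnSeries Γ K).orderTop := by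
  constructor
  · rintro ⟨c, rfl⟩
    rw [Subring.coe_mul, mul_comm]
    exact le_orderTop_mul_left c.2.2 le_rfl
  · intro h
    by_cases ha : (a : HahnSeries Γ K) = 0
    · have hb : (b : HahnSeries Γ K) = 0 := by
        rw [ha, orderTop_zero, top_le_iff, orderTop_eq_top] at h
        exact h
      exact ⟨0, Subtype.ext (by simp [hb])⟩
    · refine ⟨⟨b / a, div_mem b.2.1 a.2.1, ?_⟩, Subtype.ext ?_⟩
      · rw [div_eq_mul_inv, orderTop_mul, ← orderTop_inv_add _ ha]
        gcongr
      · rw [Subring.coe_mul]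
        field_simp

theorem isUnit_iff_orderTop_eq_zero {a : integerSubring F} :
    IsUnit a ↔ (a : HahnSeries Γ K).orderTop = 0 := by
  rw [isUnit_iff_dvd_one, dvd_iff_orderTop_le, Subring.coe_one, orderTop_one]
  exact ⟨fun h => le_antisymm h a.2.2, fun h => h.le⟩

instance : ValuationRing (integerSubring F) := by
  rw [ValuationRing.iff_dvd_total]
  exact ⟨fun a b => by
    rw [dvd_iff_orderTop_le, dvd_iff_orderTop_le]
    exact le_total _ _⟩

end HahnSeries

/-! ### Incompleteness and standardness over the generic ring -/

namespace GenericHahn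

open HahnSeries

variable {Γ I W : Type*} [AddCommGroup Γ] [LinearOrder Γ] [IsOrderedAddMonoid Γ]
  [LinearOrder W] [WellFoundedLT W] [LinearOrder I] [WellFoundedLT I]
  {γ : W → Γ} {e : I → W → W → Series Γ I W}

/-- Below each limit ordinal there is a coherent system of elements of the base field whose limit is
realized nowhere in the generic extension. -/
theorem exists_unrealized [Nonempty I] (hpos : ∀ μ, 0 < γ μ) (hmono : StrictMono γ)
    (iso : Omega1 ≃o W) {δ : Omega1} (hδ : Order.IsSuccLimit δ) :
    ∃ a : Omega1 → Series Γ I W, (∀ ν, a ν ∈ baseField γ e) ∧ (∀ ν, 0 ≤ (a ν).orderTop) ∧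
      (∀ μ ν, μ ≤ ν → ν < δ → (γ (iso μ) : WithTop Γ) ≤ (a μ - a ν).orderTop) ∧
      ¬ ∃ f ∈ layer γ e Set.univ, ∀ ν < δ, (γ (iso ν) : WithTop Γ) ≤ (f - a ν).orderTop := by
  classical
  have hmono' : StrictMono (γ ∘ iso) := hmono.comp iso.strictMono
  let i₀ : I := Classical.arbitrary I
  let x : Omega1 → Var I W := fun ν => (false, i₀, some (iso ν))
  have hx : ∀ ν, x ν ∈ baseVars I W := fun ν => rfl
  have hxinj : Function.Injective x := fun μ ν h => by
    simpa [x] using h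
  obtain ⟨D, hDδ, hDfin, hDcof⟩ := Omega1.exists_ladder hδ
  let T : Omega1 → Finset Omega1 := fun ν =>
    if h : (D ∩ Set.Iio ν).Finite then h.toFinset else ∅
  have hT : ∀ ν < δ, ∀ μ, μ ∈ T ν ↔ μ ∈ D ∧ μ < ν := by
    intro ν hν μ
    simp only [T, dif_pos (hDfin ν hν), Set.Finite.mem_toFinset]
    exact Iff.rfl
  let t : Omega1 → Series Γ I W := fun μ => single (γ (iso μ)) (gen (x μ))
  -- Partial sums over the finite sets D ∩ ν; the default value of `T`, used when D ∩ ν is infinite,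
  -- plays no role for ν < δ.
  let a : Omega1 → Series Γ I W := fun ν => ∑ μ ∈ T ν, t μ
  have htbase : ∀ μ, t μ ∈ baseField γ e := by
    intro μ
    have : t μ = C (gen (x μ)) * single (γ (iso μ)) 1 := by
      rw [C_apply, single_mul_single]; simp [t]
    rw [this]
    exact mul_mem (C_gen_mem_layer _ (hx μ)) (single_mem_layer _ _)
  have hta : ∀ μ ν, μ ≤ ν → ν < δ → (γ (iso μ) : WithTop Γ) ≤ (a μ - a ν).orderTop := by
    intro μ ν hμν hν
    have hsub : T μ ⊆ T ν := by
      intro κ hκ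
      rw [hT μ (hμν.trans_lt hν)] at hκ
      rw [hT ν hν]
      exact ⟨hκ.1, hκ.2.trans_le hμν⟩
    rw [orderTop_sub_comm]
    simp only [a]
    rw [← Finset.sum_sdiff hsub, add_sub_cancel_right]
    refine le_orderTop_sum _ _ fun κ hκ => ?_
    rw [Finset.mem_sdiff, hT ν hν, hT μ (hμν.trans_lt hν)] at hκ
    have hle : μ ≤ κ := by
      by_contra h
      exact hκ.2 ⟨hκ.1.1, not_le.1 h⟩
    refine le_trans ?_ orderTop_single_le
    exact_mod_cast hmono'.monotone hle
  have hcoeff : ∀ ν < δ, ∀ μ ∈ D, μ < ν → (a ν).coeff (γ (iso μ)) = gen (x μ) := by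
    intro ν hν μ hμ hμν
    have hmem : μ ∈ T ν := (hT ν hν μ).2 ⟨hμ, hμν⟩
    simp only [a]
    rw [coeff_sum, Finset.sum_eq_single μ]
    · simp [t]
    · intro κ _ hκ
      exact coeff_single_of_ne fun h => hκ (hmono'.injective h).symm
    · exact fun h => (h hmem).elim
  refine ⟨a, fun ν => sum_mem fun μ _ => htbase μ, ?_, hta, ?_⟩
  · intro ν
    refine le_orderTop_sum _ _ fun μ _ => le_trans ?_ orderTop_single_le
    exact_mod_cast (hpos _).le
  · rintro ⟨f, hf, hfa⟩
    -- A limit `w` over the base variables exists among all Hahn series. Since `f` is as close to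
    -- `w` as every `γ ν` demands, so is some `g` in the base field.
    obtain ⟨w, hw1, hw2⟩ := exists_limit (γ := γ ∘ iso) (s := Set.Iio δ) (a := a)
      (fun μ _ ν hν h => hta μ ν h.le hν)
    have hwmem : w ∈ coeffSubfield Γ (varField (baseVars I W)) := by
      rw [mem_coeffSubfield]
      intro g
      rcases hw2 g with h | ⟨μ, -, h⟩
      · rw [h]; exact zero_mem _
      · rw [h]
        refine mem_coeffSubfield.1 (sum_mem fun κ _ => ?_) g
        exact single_mem_coeffSubfield (gen_mem_varField (hx κ))
    obtain ⟨g, hg, hgw⟩ := approxBy_layer hpos hmono Set.univ f hf w hwmem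
    have hga : ∀ ν < δ, (γ (iso ν) : WithTop Γ) ≤ (a ν - g).orderTop := by
      intro ν hν
      refine le_orderTop_sub_trans (hw1 ν hν) (le_trans ?_ hgw)
      rw [orderTop_sub_comm]
      refine le_orderTop_sub_trans (y := a ν) (hfa ν hν) (hw1 ν hν)
    obtain ⟨S, hS, hgS⟩ := exists_finite_vars hg
    -- The coefficient of `g` at `γ (iso μ)` must be the variable `x μ`, so `D` would be finite,
    -- though cofinal in a limit.
    have hDS : x '' D ⊆ S := by
      rintro _ ⟨μ, hμ, rfl⟩
      by_contra hn
      apply gen_notMem_varField hn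
      obtain ⟨ν, hμν, hν⟩ := (hδ.isSuccPrelimit.lt_iff_exists_lt).1 (hDδ hμ)
      have h1 := le_orderTop_iff_coeff.1 (hga ν hμν) (γ (iso μ)) (hmono' hν)
      rw [coeff_sub, hcoeff ν hμν μ hμ hν, sub_eq_zero] at h1
      rw [h1]
      exact mem_coeffSubfield.1 hgS _
    have hDfinite : D.Finite := (hS.subset hDS).of_finite_image hxinj.injOn
    have hne : D.Nonempty := by
      obtain ⟨y, hy⟩ := not_isMin_iff.1 hδ.1
      obtain ⟨μ, hμ, -⟩ := hDcof y hy
      exact ⟨μ, hμ⟩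
    obtain ⟨m, hm, hmax⟩ := hDfinite.exists_maximal hne
    obtain ⟨ν, hν, hmν⟩ := (hδ.isSuccPrelimit.lt_iff_exists_lt).1 (hDδ hm)
    obtain ⟨μ, hμ, hle⟩ := hDcof ν hν
    exact (hmν.trans_le hle).not_ge (hmax hμ (hmν.trans_le hle).le)

section Ring

variable (γ e) in
/-- The valuation ring of the generic extension. -/
abbrev GenericRing : Type _ := integerSubring (layer γ e Set.univ)

variable (e) in
/-- The monomials with exponents `γ ν`. -/
noncomputable def monomial (hpos : ∀ μ, 0 < γ μ) (ν : W) : GenericRing γ e :=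
  ⟨single (γ ν) 1, single_mem_layer _ _, by
    rw [orderTop_single_one]; exact_mod_cast (hpos ν).le⟩

variable (hpos : ∀ μ, 0 < γ μ)

theorem monomial_dvd_iff {ν : W} {x : GenericRing γ e} :
    monomial e hpos ν ∣ x ↔ (γ ν : WithTop Γ) ≤ (x : Series Γ I W).orderTop := by
  rw [dvd_iff_orderTop_le, monomial, orderTop_single_one]

theorem monomial_ne_zero (ν : W) : monomial e hpos ν ≠ 0 := fun h =>
  single_one_ne_zero (g := γ ν) (congrArg Subtype.val h)

theorem not_isUnit_monomial (ν : W) : ¬ IsUnit (monomial e hpos ν) := by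
  rw [isUnit_iff_orderTop_eq_zero, monomial, orderTop_single_one]
  exact_mod_cast (hpos ν).ne'

theorem monomial_dvd_monomial (hmono : StrictMono γ) {μ ν : W} (h : μ < ν) :
    monomial e hpos μ ∣ monomial e hpos ν := by
  rw [monomial_dvd_iff, monomial, orderTop_single_one]
  exact_mod_cast (hmono h).le

theorem exists_dvd_monomial (hcof : ∀ g, ∃ ν, g < γ ν) {x : GenericRing γ e} (hx : x ≠ 0) :
    ∃ ν, x ∣ monomial e hpos ν ∧ ¬ monomial e hpos ν ∣ x := by
  have hx' : (x : Series Γ I W) ≠ 0 := fun h => hx (Subtype.ext h)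
  obtain ⟨g, hg⟩ := WithTop.ne_top_iff_exists.1 (orderTop_ne_top.2 hx')
  obtain ⟨ν, hν⟩ := hcof g
  refine ⟨ν, ?_, ?_⟩
  · rw [dvd_iff_orderTop_le, monomial, orderTop_single_one, ← hg]
    exact_mod_cast hν.le
  · rw [monomial_dvd_iff, ← hg]
    exact_mod_cast hν.not_ge

include hpos in
theorem gammaEq_genericRing [Nonempty I] (hmono : StrictMono γ) (hcof : ∀ g, ∃ ν, g < γ ν)
    (iso : Omega1 ≃o W) :
    GammaEq (⊤ : Submodule (GenericRing γ e) (FractionRing (GenericRing γ e))) 1 1 := by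
  refine gammaEq_one_of_unrealized (ρ := fun ν => monomial e hpos (iso ν))
    (fun ν => monomial_ne_zero hpos _)
    (fun μ ν h => monomial_dvd_monomial hpos hmono (iso.strictMono h)) (fun x hx => ?_)
    (fun δ hδ => ?_)
  · obtain ⟨ν, hν, -⟩ := exists_dvd_monomial hpos hcof hx
    exact ⟨iso.symm ν, by simpa using hν⟩
  · obtain ⟨a, ha, ha0, hcomp, hun⟩ := exists_unrealized (e := e) hpos hmono iso hδ
    refine ⟨fun ν => ⟨a ν, layer_mono (Set.empty_subset _) (ha ν), ha0 ν⟩, ?_, ?_⟩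
    · intro μ ν h hν
      rw [monomial_dvd_iff]
      exact hcomp μ ν h hν
    · rintro ⟨f, hf⟩
      refine hun ⟨f, f.2.1, fun ν hν => ?_⟩
      exact (monomial_dvd_iff hpos).1 (hf ν hν)

include hpos in
-- Closing-off argument: the entries of a cocycle over the ring all occur before some stage β, and
-- the cocycle is listed at some α ≥ β. Stage α is then good and adjoins units trivializing it.
theorem isStandard_genericRing [Nonempty I] [NoMaxOrder I] [Nonempty W] (hmono : StrictMono γ)
    (hcof : ∀ g, ∃ ν, g < γ ν) (hbdd : ∀ b : W → W → I, ∃ β, ∀ μ ν, b μ ν < β)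
    (henum : ∀ (e' : W → W → Series Γ I W) (β : I), ∃ α ≥ β, e α = e')
    {U : Type*} [AddCommGroup U] [Module (GenericRing γ e) U] (hU : IsUniserial (GenericRing γ e) U)
    (hT : HasType U (⊤ : Submodule (GenericRing γ e) (FractionRing (GenericRing γ e))) 1) :
    IsStandard (GenericRing γ e) U := by
  refine isStandard_of_cocycles_trivial (r := monomial e hpos) (monomial_ne_zero hpos)
    (not_isUnit_monomial hpos) (fun μ ν h => monomial_dvd_monomial hpos hmono h)
    (fun x hx => (exists_dvd_monomial hpos hcof hx).imp fun ν h => h.2) ?_ hU hT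
  intro c hcu hc
  choose b hb using fun μ ν => exists_mem_layer_Iio (c μ ν).2.1
  obtain ⟨β, hβ⟩ := hbdd b
  obtain ⟨α, hα, hαc⟩ := henum (fun μ ν => c μ ν) β
  have hgood : Good γ e α := by
    rw [good_iff, hαc]
    refine ⟨⟨fun μ ν _ => isUnit_iff_orderTop_eq_zero.1 (hcu μ ν), fun μ ν τ h h' => ?_⟩, ?_⟩
    · exact (monomial_dvd_iff hpos).1 (hc μ ν τ h h')
    · intro μ ν
      exact layer_mono (Set.Iio_subset_Iio ((hβ μ ν).le.trans hα)) (hb μ ν)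
  have hunit := orderTop_genericUnit hpos hgood
  refine ⟨fun ν => ⟨genericUnit γ (e α) α ν,
    genericUnit_mem_layer (Set.mem_univ α) hgood ν, (hunit ν).ge⟩, fun ν => ?_, fun μ ν h => ?_⟩
  · exact isUnit_iff_orderTop_eq_zero.2 (hunit ν)
  · rw [monomial_dvd_iff]
    have := le_orderTop_genericUnit hpos hmono hgood h
    rw [show e α μ ν = c μ ν from congrFun (congrFun hαc μ) ν] at this
    exact this

theorem span_inv_monomial_eq_top (hcof : ∀ g, ∃ ν, g < γ ν) :
    Submodule.span (GenericRing γ e) (Set.range fun ν =>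
      (algebraMap (GenericRing γ e) (FractionRing (GenericRing γ e)) (monomial e hpos ν))⁻¹) = ⊤ := by
  rw [eq_top_iff]
  intro z _
  obtain ⟨a, b, hb, rfl⟩ := IsFractionRing.div_surjective (A := GenericRing γ e) z
  have hb0 : b ≠ 0 := nonZeroDivisors.ne_zero hb
  obtain ⟨ν, hν, -⟩ := exists_dvd_monomial hpos hcof hb0
  rw [div_eq_mul_inv, ← Algebra.smul_def]
  refine Submodule.smul_mem _ _ (Submodule.span_mono ?_
    ((inv_mem_invSpan_iff hb0 (monomial_ne_zero hpos ν)).2 hν))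
  rintro _ rfl
  exact ⟨ν, rfl⟩

theorem inv_monomial_injective (hmono : StrictMono γ) : Function.Injective fun ν =>
    (algebraMap (GenericRing γ e) (FractionRing (GenericRing γ e)) (monomial e hpos ν))⁻¹ := by
  intro μ ν h
  have h1 := IsFractionRing.injective (GenericRing γ e) (FractionRing (GenericRing γ e))
    (inv_injective h)
  have h2 := congrArg (fun x : GenericRing γ e => (x : Series Γ I W).orderTop) h1
  simp only [monomial, orderTop_single_one] at h2
  exact hmono.injective (WithTop.coe_injective h2)

end Ring

end GenericHahn

/-! ### The exponent group, cardinalities and bookkeeping -/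

namespace GenericHahn

open HahnSeries Cardinal

section Exponents

variable (W : Type*) [LinearOrder W]

/-- The exponent group: finitely supported integer functions on `W`, compared at the largest place
where they differ. -/
abbrev Exponents := Colex (W →₀ ℤ)

instance : IsOrderedAddMonoid (Exponents W) where
  add_le_add_left _ _ h c := by gcongr

variable {W}

/-- The exponents `γ ν`. -/
noncomputable def exponent (ν : W) : Exponents W := toColex (Finsupp.single ν 1)

theorem exponent_strictMono : StrictMono (exponent : W → Exponents W) := by
  intro μ ν h
  rw [Finsupp.Colex.lt_iff]
  refine ⟨ν, fun j hj => ?_, ?_⟩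
  · change Finsupp.single μ (1 : ℤ) j = Finsupp.single ν 1 j
    rw [Finsupp.single_eq_of_ne hj.ne', Finsupp.single_eq_of_ne (h.trans hj).ne']
  · change Finsupp.single μ (1 : ℤ) ν < Finsupp.single ν 1 ν
    rw [Finsupp.single_eq_of_ne h.ne']
    simp

theorem exponent_pos (ν : W) : 0 < exponent ν := by
  rw [Finsupp.Colex.lt_iff]
  refine ⟨ν, fun j hj => ?_, ?_⟩
  · change (0 : ℤ) = Finsupp.single ν 1 j
    rw [Finsupp.single_eq_of_ne hj.ne']
  · change (0 : ℤ) < Finsupp.single ν 1 ν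
    simp

theorem exists_lt_exponent [Nonempty W] [NoMaxOrder W] (g : Exponents W) :
    ∃ ν, g < exponent ν := by
  obtain ⟨ν, hν⟩ : ∃ ν, ∀ μ ∈ (ofColex g).support, μ < ν := by
    obtain ⟨M, hM⟩ := (ofColex g).support.exists_le
    obtain ⟨ν, hν⟩ := exists_gt M
    exact ⟨ν, fun μ hμ => (hM μ hμ).trans_lt hν⟩
  have h0 : ∀ j, ν ≤ j → ofColex g j = 0 := fun j hj => by
    by_contra h
    exact (hν j (Finsupp.mem_support_iff.2 h)).not_ge hj
  refine ⟨ν, ?_⟩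
  rw [Finsupp.Colex.lt_iff]
  refine ⟨ν, fun j hj => ?_, ?_⟩
  · change ofColex g j = Finsupp.single ν 1 j
    rw [Finsupp.single_eq_of_ne hj.ne', h0 j hj.le]
  · change ofColex g ν < Finsupp.single ν 1 ν
    rw [h0 ν le_rfl]
    simp

end Exponents

theorem mk_exponents {W : Type u} [LinearOrder W] (hW : #W = ℵ₁) : #(Exponents W) = ℵ₁ := by
  have : Infinite W := by
    rw [infinite_iff, hW]; exact aleph0_lt_aleph_one.le
  change #(W →₀ ℤ) = ℵ₁
  rw [mk_finsupp_lift_of_infinite, hW]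
  simp

theorem mk_coeffField_le {I W : Type u} (hI : #I = 2 ^ (ℵ₁ : Cardinal.{u})) (hW : #W = ℵ₁) :
    #(CoeffField I W) ≤ 2 ^ (ℵ₁ : Cardinal.{u}) := by
  have h1 : (ℵ₁ : Cardinal.{u}) ≤ 2 ^ (ℵ₁ : Cardinal.{u}) := (cantor _).le
  have h0 : (ℵ₀ : Cardinal.{u}) ≤ 2 ^ (ℵ₁ : Cardinal.{u}) := aleph0_lt_aleph_one.le.trans h1
  refine (IsLocalization.cardinalMk_le (nonZeroDivisors (MvPolynomial (Var I W) ℚ))).trans ?_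
  refine MvPolynomial.cardinalMk_le_max_lift.trans ?_
  refine max_le (max_le ?_ ?_) h0
  · simpa using h0
  · rw [lift_uzero, mk_prod, mk_prod, mk_option, hI, hW]
    simp only [lift_id, lift_uzero]
    refine mul_le_of_le h0 ?_ (mul_le_of_le h0 le_rfl ?_)
    · simpa using (natCast_le_aleph0 (n := 2)).trans h0
    · exact add_le_of_le h0 h1 (one_le_aleph0.trans h0)

theorem mk_series_le {I W : Type u} [LinearOrder W] (hI : #I = 2 ^ (ℵ₁ : Cardinal.{u}))
    (hW : #W = ℵ₁) : #(Series (Exponents W) I W) ≤ 2 ^ (ℵ₁ : Cardinal.{u}) := by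
  refine (mk_le_of_injective (f := HahnSeries.coeff) HahnSeries.coeff_injective).trans ?_
  rw [mk_arrow, lift_id, lift_id, mk_exponents hW]
  refine (power_le_power_right (mk_coeffField_le hI hW)).trans ?_
  rw [← power_mul, mul_eq_self aleph0_lt_aleph_one.le]

theorem exists_bound {I W : Type u} [LinearOrder I] [WellFoundedLT I]
    (hI : ℵ₁ < Order.cof I) (hW : #W = ℵ₁) (b : W → W → I) : ∃ β, ∀ μ ν, b μ ν < β := by
  have h : ¬ IsCofinal (Set.range fun p : W × W => b p.1 p.2) := by
    intro h
    refine ((Order.cof_le h).trans mk_range_le).not_gt ?_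
    rwa [mk_prod, lift_id, hW, mul_eq_self aleph0_lt_aleph_one.le]
  simpa [IsCofinal] using h

/-- A well-order of initial type enumerates a set of at most its own cardinality in such a way that
each element occurs cofinally often. -/
theorem exists_enumeration {I E : Type u} [LinearOrder I] [WellFoundedLT I] [Nonempty E]
    [Infinite I] (hI : ∀ β : I, #(Set.Iio β) < #I) (hE : #E ≤ #I) :
    ∃ e : I → E, ∀ (x : E) (β : I), ∃ α ≥ β, e α = x := by
  have h : #(E × I) = #I := by
    rw [mk_prod, lift_id, lift_id]
    exact mul_eq_right (aleph0_le_mk I) hE (mk_ne_zero E)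
  obtain ⟨f⟩ := Cardinal.eq.1 h
  refine ⟨fun α => (f.symm α).1, fun x β => ?_⟩
  -- Otherwise the fibre over `x`, which has as many elements as `I`, would lie in a proper initial
  -- segment.
  by_contra! hlt
  refine (hI β).not_ge (mk_le_of_injective (f := fun i : I => (⟨f (x, i), ?_⟩ : Set.Iio β)) ?_)
  · by_contra hn
    exact hlt (f (x, i)) (not_lt.1 hn) (by simp)
  · intro i j hij
    simpa using congrArg Subtype.val hij

/-- Γ is indexed by `Omega1`, which lives in `Type 1`, whereas the ring is built in `Type u` from a
copy of ω₁ there. -/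
theorem nonempty_orderIso_omega1 :
    Nonempty (Omega1 ≃o (Ordinal.omega 1 : Ordinal.{u}).ToType) := by
  have h : Ordinal.lift.{u} (Ordinal.type fun x y : Omega1 => x < y) =
      Ordinal.lift.{1} (Ordinal.type fun x y : (Ordinal.omega 1 : Ordinal.{u}).ToType => x < y) := by
    rw [Ordinal.type_toType, Ordinal.lift_omega, Ordinal.type_Iio_lt, Ordinal.typein_ordinal]
    simp [Ordinal.lift_omega]
  obtain ⟨f⟩ := Ordinal.lift_type_eq.{1, u, 0}.1 h
  exact ⟨OrderIso.ofRelIsoLT f⟩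

end GenericHahn

/-! ### The main theorem -/

open GenericHahn HahnSeries Cardinal in
/-- `Q/R` is the type with `J = ⊤` (all of `Q`) and `A = 1` (the image of `R` in `Q`). -/
theorem theorem16 :
    ∃ (R : Type u) (_ : CommRing R) (_ : IsDomain R) (_ : ValuationRing R),
      ¬ IsField R ∧
      Cardinal.mk R = 2 ^ Cardinal.aleph 1 ∧
      (∃ s : Set (FractionRing R),
        Cardinal.mk s = Cardinal.aleph 1 ∧ Submodule.span R s = ⊤) ∧
      GammaEq (⊤ : Submodule R (FractionRing R)) 1 1 ∧
      ∀ (U : Type v) [AddCommGroup U] [Module R U],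
        IsUniserial R U → HasType U (⊤ : Submodule R (FractionRing R)) 1 → IsStandard R U := by
  let W : Type u := (Ordinal.omega 1 : Ordinal.{u}).ToType
  let I : Type u := (2 ^ (ℵ₁ : Cardinal.{u}) : Cardinal.{u}).ord.ToType
  obtain ⟨iso⟩ := nonempty_orderIso_omega1.{u}
  have hW : #W = ℵ₁ := by simp [W]
  have hI : #I = 2 ^ (ℵ₁ : Cardinal.{u}) := by simp [I]
  have hκ : (ℵ₀ : Cardinal.{u}) ≤ 2 ^ (ℵ₁ : Cardinal.{u}) :=
    aleph0_lt_aleph_one.le.trans (cantor _).le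
  have : Infinite I := by rw [infinite_iff, hI]; exact hκ
  have : Infinite W := by rw [infinite_iff, hW]; exact aleph0_lt_aleph_one.le
  have : NoMaxOrder I := Cardinal.noMaxOrder hκ
  have : NoMaxOrder W := by
    have := Cardinal.noMaxOrder (c := (ℵ₁ : Cardinal.{u})) aleph0_lt_aleph_one.le
    rwa [ord_aleph] at this
  -- König's theorem: the cofinality of 2^ℵ₁ exceeds ℵ₁.
  have hcofI : ℵ₁ < Order.cof I := by
    rw [Ordinal.cof_toType]
    exact lt_cof_ord_power aleph0_lt_aleph_one.le (by norm_num)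
  -- There are at most 2^ℵ₁ series, hence at most (2^ℵ₁)^(ℵ₁·ℵ₁) = 2^ℵ₁ candidate cocycles.
  have hE : #(W → W → Series (Exponents W) I W) ≤ #I := by
    simp only [mk_arrow, lift_id]
    rw [hI, hW]
    refine (power_le_power_right (power_le_power_right (mk_series_le hI hW))).trans ?_
    rw [← power_mul, ← power_mul, mul_eq_self aleph0_lt_aleph_one.le,
      mul_eq_self aleph0_lt_aleph_one.le]
  obtain ⟨e, he⟩ := exists_enumeration (I := I) (fun β => mk_Iio_lt β (by simp [I])) hE
  have hpos := exponent_pos (W := W)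
  have hmono := exponent_strictMono (W := W)
  have hcof := exists_lt_exponent (W := W)
  refine ⟨GenericRing exponent e, inferInstance, inferInstance, inferInstance, ?_, ?_, ?_, ?_, ?_⟩
  · intro h
    obtain ⟨b, hb⟩ := h.mul_inv_cancel (monomial_ne_zero (e := e) hpos (Classical.arbitrary W))
    exact not_isUnit_monomial hpos _ (IsUnit.of_mul_eq_one b hb)
  · refine le_antisymm ((mk_le_of_injective Subtype.val_injective).trans (mk_series_le hI hW)) ?_
    -- The base constants alone supply 2^ℵ₁ elements; this is why the base variables are also
    -- indexed by `I`.
    refine hI.ge.trans (mk_le_of_injective (f := fun i : I =>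
      (⟨C (gen (false, i, none)), C_gen_mem_layer _ rfl, orderTop_single_le (a := 0)⟩ :
        GenericRing exponent e)) ?_)
    intro i j h
    have := gen_injective (C_injective (congrArg Subtype.val h))
    simpa using this
  · exact ⟨_, (mk_range_eq _ (inv_monomial_injective (e := e) hpos hmono)).trans hW,
      span_inv_monomial_eq_top hpos hcof⟩
  · exact gammaEq_genericRing hpos hmono hcof iso
  · intro U _ _ hU hT
    exact isStandard_genericRing hpos hmono hcof (exists_bound hcofI hW) he hU hT
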